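/- **Setting.** Let $L,l,\varepsilon,\theta>0$ with $\theta\le\pi/2$, let $0<\tau<\lambda$, and $\Omega=[-L,L]\times[-2L,0]$. Let $b_1=(\cos\varphi,\sin\varphi)$, $b_2=(\cos\eta,\sin\eta)$, $\mathcal B=\mathbb Z b_1+\mathbb Z b_2$, and let $R_\alpha$ be the counterclockwise rotation by $\alpha$. $B_\delta(S)$ is the open $\delta$-neighbourhood of $S$. The class $\mathcal C_\varepsilon(\Omega)$ consists of the pairs $(\beta,S)$ with $\beta\in L^1(\Omega;\mathbb R^{2\times2})$ and $S\subset\Omega$ relatively closed such that * (H1) $\beta\in L^2(\Omega\setminus\overline{B_{\lambda\varepsilon}(S)})$, and the distributional row-wise curl of $\beta$ in the interior of $\Omega$ is supported in $S$; * (H2) $\int_\gamma\beta t\,d\mathcal H^1\in\tau\varepsilon\mathcal B$ for every simple closed Lipschitz curve $\gamma\subset\Omega\setminus\overline{B_{\lambda\varepsilon}(S)}$ (counterclockwise, in the sense of the weak tangential trace); * (H3) $\beta=R_{-\theta}$ a.e. in $[-L,-L+l]\times[-2L,0]$ and $\beta=R_\theta$ a.e. in $[L-l,L]\times[-2L,0]$.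 The energy is $$\mathcal F_\varepsilon(\beta,S)=\int_{\Omega\setminus B_{\lambda\varepsilon}(S)}\operatorname{dist}^2(\beta,SO(2))\,dx+\frac{\tau^2}{\lambda^2}\,\mathcal L^2(B_{\lambda\varepsilon}(S)).$$ Put $$\ell_1=-\frac{\tau\varepsilon}{4}\,\frac{\sin(\varphi-\eta)}{\sin\theta\,\sin\eta},\qquad \ell_2=\frac{\tau\varepsilon}{4}\,\frac{\sin(\varphi-\eta)}{\sin\theta\,\sin\varphi},$$ and assume the smallness conditions $\lambda\varepsilon\le|\ell_i|$ and $l+2|\ell_i|\le L$ for $i=1,2$. **Construction.** Assume the sign conditions $\frac{\sin(\varphi-\eta)}{\sin\eta}<0<\frac{\sin(\varphi-\eta)}{\sin\varphi}$ (so $\ell_i>0$). For $i=1,2$ let $\bar n_i=\lfloor\log_2(\ell_i/(\lambda\varepsilon))\rfloor$, $r_{i,n}=2^{n-\bar n_i}\ell_i$ (so $\lambda\varepsilon\le r_{i,0}<2\lambda\varepsilon$ and $r_{i,\bar n_i}=\ell_i$), $N_i=\lceil L/\ell_i\rceil$ and $t_{i,k}=((-1)^i\ell_i,-(2k-1)\ell_i)$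 for $1\le k\le N_i$. The cores are $D_{i,k}=t_{i,k}+[-r_{i,0},r_{i,0}]^2$. For $1\le n\le\bar n_i$ and $s=(-1)^{i+1}$ let, up to translation by $t_{i,k}$, $$\Delta^{a,n}_{i,k}=\operatorname{conv}\{(sr_{i,n-1},-r_{i,n-1}),(sr_{i,n},r_{i,n}),(sr_{i,n-1},r_{i,n-1})\},$$ $$\Delta^{b,n}_{i,k}=\operatorname{conv}\{(sr_{i,n-1},-r_{i,n-1}),(sr_{i,n},-r_{i,n}),(sr_{i,n},r_{i,n})\}.$$ The strain $\beta$ is the identity in the cores. On each triangle it is the gradient of the affine map whose value at a vertex $q$ is $R_{(-1)^i\theta}\,q+s(k+\sigma)\tau\varepsilon b_i$, where $\sigma=0$ at the vertices in the upper half of the square $t_{i,k}+[-\ell_i,\ell_i]^2$ and $\sigma=1$ at those in its lower half. In the rest of $\Omega$, $\beta$ is $R_{-\theta}$ for $x_1<0$ and $R_\theta$ for $x_1>0$. Let $\hat S=\bigcup_{i,k}\partial D_{i,k}$ and $S=\Omega\cap\hat S$. **Claim 1.** There is a universal constant $C>0$ such that, for all parameters as above satisfying the sign conditions: 1. $(\beta,S)\in\mathcal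 C_\varepsilon(\Omega)$; 2. for every simple closed Lipschitz curve $\gamma\subset\Omega\setminus S$ that encloses $D_{i,k}$ and whose enclosed region is disjoint from all other cores, $\int_\gamma\beta t\,d\mathcal H^1=-\tau\varepsilon b_i$; 3. $$\mathcal F_\varepsilon(\beta,S)\le C\,\varepsilon L\,E_0\sin\theta\,(A-\log_2\sin\theta),$$ and the same bound holds for $\mathcal F_\varepsilon(\beta,\hat S)$. Here $E_0=\tau\,\frac{\sin\varphi-\sin\eta}{\sin(\varphi-\eta)}$, $A=1+E_1/E_0$ and $$E_1=\tau\Big(\tfrac{\sin\varphi}{\sin(\varphi-\eta)}\log_2\tfrac{\tau\sin(\varphi-\eta)}{4\lambda\sin\varphi}-\tfrac{\sin\eta}{\sin(\varphi-\eta)}\log_2\Big(-\tfrac{\tau\sin(\varphi-\eta)}{4\lambda\sin\eta}\Big)\Big);$$ 4. explicitly, $$A=1+\log_2\frac{\tau|\sin(\varphi-\eta)|}{4\lambda}+\frac{\sin\eta\,\log_2|\sin\eta|-\sin\varphi\,\log_2|\sin\varphi|}{\sin\varphi-\sin\eta}.$$ **Claim 2.** Let $0<\tau<\lambda$ and let $\varphi,\eta$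 satisfy $\sin\varphi,\sin\eta,\sin(\varphi-\eta)\neq0$ (no sign conditions). There is a constant $C>0$, depending only on $\tau,\lambda,\varphi,\eta$, such that for all $L,l,\varepsilon,\theta$ as in the setting, including the smallness conditions, $$\inf_{\mathcal C_\varepsilon(\Omega)}\mathcal F_\varepsilon\le C\,L\,\varepsilon\,\theta\,(|\log\theta|+1).$$ -/

import Mathlib

open scoped ContDiff Topology ENNReal

noncomputable section

namespace GrainBoundary

/-- The Euclidean plane. -/
abbrev Plane : Type := EuclideanSpace ℝ (Fin 2)

/-- The space of strains at a point. -/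
abbrev Mat : Type := Matrix (Fin 2) (Fin 2) ℝ

/-- The counterclockwise rotation of angle `θ`. -/
def rot (θ : ℝ) : Mat := !![Real.cos θ, -Real.sin θ; Real.sin θ, Real.cos θ]

/-- The unit vector `(cos a, sin a)`. -/
def unitVec (a : ℝ) : Plane := !₂[Real.cos a, Real.sin a]

/-- Frobenius distance from a matrix to `SO(2)`. -/
def distSO2 (M : Mat) : ℝ :=
  ⨅ Q : Matrix.specialOrthogonalGroup (Fin 2) ℝ,
    Real.sqrt (∑ i, ∑ j, (M i j - (Q : Mat) i j) ^ 2)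

/-- The partial derivative `∂ⱼ ψ`. -/
def partialD (j : Fin 2) (ψ : Plane → ℝ) (x : Plane) : ℝ :=
  fderiv ℝ ψ x (EuclideanSpace.single j 1)

/-- The real parameters of the model: the size `L` of the domain, the width `l` of the boundary
layer where the strain is prescribed, the small parameter `ε`, the misorientation angle `θ`, the
lattice spacing `τ ε`, the core radius `lam ε`, and the directions `φ`, `η` of the two generators
of the lattice. -/
structure Params where
  L : ℝ
  l : ℝ
  ε : ℝ
  θ : ℝ
  τ : ℝ
  lam : ℝ
  φ : ℝ
  η : ℝ

/-! ### The semi-discrete energy and its admissible class -/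

/-- The domain `[-L, L] × [-2L, 0]`. -/
def Omega (p : Params) : Set Plane :=
  {x | x 0 ∈ Set.Icc (-p.L) p.L ∧ x 1 ∈ Set.Icc (-2 * p.L) 0}

/-- Direction of the generators: index `0` stands for `b₁`, index `1` for `b₂`. -/
def angle (p : Params) (i : Fin 2) : ℝ := ![p.φ, p.η] i

/-- The generators `b₁ = (cos φ, sin φ)` and `b₂ = (cos η, sin η)`. -/
def gen (p : Params) (i : Fin 2) : Plane := unitVec (angle p i)

/-- The Bravais lattice generated by `b₁`, `b₂`. -/
def lattice (p : Params) : Submodule ℤ Plane := Submodule.span ℤ (Set.range (gen p))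

/-- The closed core region, i.e. the closure of the neighbourhood of `S` of radius `lam ε`. -/
def closedCore (p : Params) (S : Set Plane) : Set Plane :=
  closure (Metric.thickening (p.lam * p.ε) S)

/-- `γ` is (the image of) a simple closed Lipschitz curve. -/
def IsSimpleClosedLipschitz (γ : Set Plane) : Prop :=
  ∃ (c : ℝ → Plane) (K : NNReal), LipschitzOnWith K c (Set.Icc 0 1) ∧ c 0 = c 1 ∧
    Set.InjOn c (Set.Ico 0 1) ∧ γ = c '' Set.Icc 0 1

/-- The region enclosed by `γ`: the union of the bounded components of the complement of `γ`. -/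
def enclosed (γ : Set Plane) : Set Plane :=
  {x | x ∉ γ ∧ Bornology.IsBounded (connectedComponentIn γᶜ x)}

/-- The counterclockwise circulation along `γ` of a field `β` which is curl-free off `K` equals
`v`, in the sense of the weak tangential trace `⟨T β, 1⟩ = v` given by Green's formula in the
region `Γ` enclosed by `γ`. The constant `1` on `γ` is extended by a smooth cutoff `ψ` vanishing
near `K`, and, row by row, `∫_γ β t = ∫_Γ (∂₁ψ β₂ - ∂₂ψ β₁)` because `curl β = 0` on the
support of `ψ`. -/
def HasCirculation (β : Plane → Mat) (K γ : Set Plane) (v : Plane) : Prop :=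
  ∀ ψ : Plane → ℝ, ContDiff ℝ ∞ ψ → HasCompactSupport ψ → Disjoint (tsupport ψ) K →
    (∀ᶠ x in 𝓝ˢ γ, ψ x = 1) →
    ∀ i : Fin 2, ∫ x in enclosed γ, (partialD 0 ψ x * β x i 1 - partialD 1 ψ x * β x i 0) = v i

/-- The distributional (row-wise) curl of `β` in the interior of the domain is supported
in `S`. -/
def CurlSupportedIn (p : Params) (β : Plane → Mat) (S : Set Plane) : Prop :=
  ∀ ψ : Plane → ℝ, ContDiff ℝ ∞ ψ → HasCompactSupport ψ → tsupport ψ ⊆ interior (Omega p) \ S →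
    ∀ i : Fin 2, ∫ x in Omega p, (partialD 1 ψ x * β x i 0 - partialD 0 ψ x * β x i 1) = 0

/-- Regularity: `β ∈ L²` away from the cores, with curl supported in `S`. -/
def RegularityCond (p : Params) (β : Plane → Mat) (S : Set Plane) : Prop :=
  (∀ i j, MeasureTheory.MemLp (fun x => β x i j) 2
    (MeasureTheory.volume.restrict (Omega p \ closedCore p S))) ∧
  CurlSupportedIn p β S

/-- Quantised circulation: along every simple closed Lipschitz curve avoiding the closed cores,
the circulation is in `τ ε` times the lattice. -/
def CirculationCond (p : Params) (β : Plane → Mat) (S : Set Plane) : Prop :=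
  ∀ γ : Set Plane, IsSimpleClosedLipschitz γ → γ ⊆ Omega p \ closedCore p S →
    ∃ w ∈ lattice p, HasCirculation β (closedCore p S) γ ((p.τ * p.ε) • w)

/-- Symmetric boundary conditions on the two lateral layers of width `l`. -/
def BoundaryCond (p : Params) (β : Plane → Mat) : Prop :=
  (∀ᵐ x : Plane, x ∈ Omega p → x 0 ≤ -p.L + p.l → β x = rot (-p.θ)) ∧
  (∀ᵐ x : Plane, x ∈ Omega p → p.L - p.l ≤ x 0 → β x = rot p.θ)

/-- The admissible class of pairs `(β, S)`. -/
def admissible (p : Params) : Set ((Plane → Mat) × Set Plane) :=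
  {q | (∀ i j, MeasureTheory.IntegrableOn (fun x => q.1 x i j) (Omega p)) ∧
    q.2 ⊆ Omega p ∧ IsClosed q.2 ∧
    RegularityCond p q.1 q.2 ∧ CirculationCond p q.1 q.2 ∧ BoundaryCond p q.1}

/-- The energy: elastic energy outside the cores plus the core energy. -/
def energy (p : Params) (β : Plane → Mat) (S : Set Plane) : ℝ≥0∞ :=
  (∫⁻ x in Omega p \ Metric.thickening (p.lam * p.ε) S, ENNReal.ofReal (distSO2 (β x) ^ 2)) +
    ENNReal.ofReal (p.τ ^ 2 / p.lam ^ 2) *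
      MeasureTheory.volume (Metric.thickening (p.lam * p.ε) S)

/-! ### The construction -/

/-- The sign `-1` for the left strip (index `0`) and `+1` for the right strip (index `1`). -/
def sgn (i : Fin 2) : ℝ := ![-1, 1] i

/-- The half-spacing of the dislocations in each strip; it is the half side of the squares into
which the strip is divided. -/
def spacing (p : Params) (i : Fin 2) : ℝ :=
  ![-(p.τ * p.ε / 4) * (Real.sin (p.φ - p.η) / (Real.sin p.θ * Real.sin p.η)),
    (p.τ * p.ε / 4) * (Real.sin (p.φ - p.η) / (Real.sin p.θ * Real.sin p.φ))] i

/-- The number of dyadic annuli in each square of strip `i`. -/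
def nbar (p : Params) (i : Fin 2) : ℕ := ⌊Real.logb 2 (spacing p i / (p.lam * p.ε))⌋₊

/-- The dyadic radii `r_n = 2 ^ n r_0` in strip `i`, where the inner radius `r_0` is adjusted
so that `r_n` is the spacing for `n = nbar p i`. One has `lam ε ≤ r_0 < 2 lam ε`, and
`r_0 = lam ε` when `spacing p i / (lam ε)` is a power of two. -/
def radius (p : Params) (i : Fin 2) (n : ℕ) : ℝ := 2 ^ n * (spacing p i / 2 ^ nbar p i)

/-- The number of squares in strip `i`; the squares are numbered `k = 1, …, numSq p i`. -/
def numSq (p : Params) (i : Fin 2) : ℕ := ⌈p.L / spacing p i⌉₊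

/-- The centre of the `k`-th square of strip `i`. -/
def center (p : Params) (i : Fin 2) (k : ℕ) : Plane :=
  !₂[sgn i * spacing p i, -(2 * (k : ℝ) - 1) * spacing p i]

/-- The core: the closed square of half side `r_0` about the centre of the `k`-th square. -/
def coreSq (p : Params) (i : Fin 2) (k : ℕ) : Set Plane :=
  {x | max |x 0 - center p i k 0| |x 1 - center p i k 1| ≤ radius p i 0}

/-- The boundary of the core. -/
def coreBdry (p : Params) (i : Fin 2) (k : ℕ) : Set Plane :=
  {x | max |x 0 - center p i k 0| |x 1 - center p i k 1| = radius p i 0}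

/-- The vertices of the two triangles (`false` for the upper one, `true` for the lower one) of the
`n`-th annulus, on the side facing the interface `x₁ = 0` between the strips. -/
def triVertex (p : Params) (i : Fin 2) (k n : ℕ) : Bool → Fin 3 → Plane
  | false => ![center p i k + !₂[-sgn i * radius p i (n - 1), -radius p i (n - 1)],
               center p i k + !₂[-sgn i * radius p i n, radius p i n],
               center p i k + !₂[-sgn i * radius p i (n - 1), radius p i (n - 1)]]
  | true => ![center p i k + !₂[-sgn i * radius p i (n - 1), -radius p i (n - 1)],
              center p i k + !₂[-sgn i * radius p i n, -radius p i n],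
              center p i k + !₂[-sgn i * radius p i n, radius p i n]]

/-- The triangle itself. -/
def tri (p : Params) (i : Fin 2) (k n : ℕ) (z : Bool) : Set Plane :=
  convexHull ℝ (Set.range (triVertex p i k n z))

/-- Number of Burgers vectors (on top of `k`) by which each vertex is displaced: `0` at the
vertices in the upper half of the square, `1` at those in its lower half. -/
def triShift : Bool → Fin 3 → ℝ
  | false => ![1, 0, 0]
  | true => ![1, 1, 0]

/-- The values of the deformation at the vertices: the rotation of angle `∓θ` plus a translation
along the generator of the strip. -/
def triValue (p : Params) (i : Fin 2) (k n : ℕ) (z : Bool) (j : Fin 3) : Plane :=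
  WithLp.toLp 2 (Matrix.mulVec (rot (sgn i * p.θ)) (WithLp.ofLp (triVertex p i k n z j))) +
    (-sgn i * ((k : ℝ) + triShift z j) * (p.τ * p.ε)) • gen p i

/-- The constant gradient of the affine map taking the values `v j` at the points `q j`: the matrix
`G` with `G (q j - q 0) = v j - v 0`. -/
def interpGrad (q v : Fin 3 → Plane) : Mat :=
  !![(v 1 - v 0) 0, (v 2 - v 0) 0; (v 1 - v 0) 1, (v 2 - v 0) 1] *
    (!![(q 1 - q 0) 0, (q 2 - q 0) 0; (q 1 - q 0) 1, (q 2 - q 0) 1])⁻¹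

/-- The gradient of the interpolation on each triangle. -/
def triGrad (p : Params) (i : Fin 2) (k n : ℕ) (z : Bool) : Mat :=
  interpGrad (triVertex p i k n z) (triValue p i k n z)

/-- The index `t = (i, k, n, z)` belongs to a triangle of the construction which contains `x`. -/
def InTri (p : Params) (x : Plane) (t : Fin 2 × ℕ × ℕ × Bool) : Prop :=
  1 ≤ t.2.1 ∧ t.2.1 ≤ numSq p t.1 ∧ 1 ≤ t.2.2.1 ∧ t.2.2.1 ≤ nbar p t.1 ∧
    x ∈ tri p t.1 t.2.1 t.2.2.1 t.2.2.2

open Classical in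
/-- The piecewise constant strain: the identity in the cores, the gradient of the interpolation in
each triangle, and the rotations of angle `-θ` (left half) and `θ` (right half) in all the
remaining pieces. Different triangles overlap at most in a null set, where the value is
immaterial. -/
def strain (p : Params) (x : Plane) : Mat :=
  if ∃ i k, 1 ≤ k ∧ k ≤ numSq p i ∧ x ∈ coreSq p i k then 1
  else if h : ∃ t, InTri p x t then
    triGrad p h.choose.1 h.choose.2.1 h.choose.2.2.1 h.choose.2.2.2
  else if x 0 < 0 then rot (-p.θ) else rot p.θ

/-- The union of all the core boundaries, including the part outside the domain of a last square
that sticks out of it. -/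
def allCoreBdry (p : Params) : Set Plane :=
  {x | ∃ i k, 1 ≤ k ∧ k ≤ numSq p i ∧ x ∈ coreBdry p i k}

/-- The dislocation set of the construction. -/
def dislocations (p : Params) : Set Plane := Omega p ∩ allCoreBdry p

/-! ### Constants and assumptions -/

/-- The constant `E₀`. -/
def E0 (p : Params) : ℝ :=
  p.τ * ((Real.sin p.φ - Real.sin p.η) / Real.sin (p.φ - p.η))

/-- The constant `E₁`. -/
def E1 (p : Params) : ℝ :=
  p.τ * (Real.sin p.φ / Real.sin (p.φ - p.η) *
      Real.logb 2 (p.τ * Real.sin (p.φ - p.η) / (4 * p.lam * Real.sin p.φ)) -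
    Real.sin p.η / Real.sin (p.φ - p.η) *
      Real.logb 2 (-(p.τ * Real.sin (p.φ - p.η) / (4 * p.lam * Real.sin p.η))))

/-- The constant `A`. -/
def constA (p : Params) : ℝ := E1 p / E0 p + 1

/-- Standing assumptions on the parameters; the last two say that `θ` is small (the squares
have half side at least `lam ε`) and that `ε` is small (the strips fit into the domain, leaving
the lateral layers free). -/
def Standing (p : Params) : Prop :=
  0 < p.L ∧ 0 < p.l ∧ 0 < p.ε ∧ 0 < p.θ ∧ p.θ ≤ Real.pi / 2 ∧ 0 < p.τ ∧ p.τ < p.lam ∧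
    (∀ i, p.lam * p.ε ≤ |spacing p i|) ∧ (∀ i, p.l + 2 * |spacing p i| ≤ p.L)

/-- The sign conditions on the generators, which make both spacings positive. -/
def SignCond (p : Params) : Prop :=
  Real.sin (p.φ - p.η) / Real.sin p.η < 0 ∧ 0 < Real.sin (p.φ - p.η) / Real.sin p.φ

end GrainBoundary

end

open GrainBoundary

/-!
The proof rests on an exact formula for the distributional curl of the strain. The strain is
piecewise constant, and off the finitely many lines that carry the edges of its pieces it is the
sum of the two rotations and of the contributions of the cores and triangles
(`strain_eq_of_isGeneric`). In the annuli of a square the deviation from the rotation is the Burgers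
vector times the gradient of a scalar profile, which jumps its normal derivative across three lines
only. For each line the derivative of a test function `χ` along the line is integrated by a shear
and the fundamental theorem of calculus (`setIntegral_halfStrip_tangential`), so that an annulus
just transports the mean of `χ` over the vertical edge facing the interface from the inner to the
outer radius (`sum_flux_tri`). These terms telescope: what is left is the mean of `χ` on the edge of
the core, and an integral of `χ` over the interface, which cancels against the jump of the two
rotations because of the choice of the spacings (`burgers_balance`). Hence the curl paired with a
`χ` which is constant on each core boundary is the sum of these constants times the Burgers vectors
(`setIntegral_curlDensity_strain`).

Both the support of the curl and the circulations follow. For the weak circulation along `γ`, with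
`ψ = 1` near `γ`, the formula is applied to `ψ - 1` cut off to the enclosed region; a core boundary
is connected and does not meet `γ`, so it lies either in the enclosed region, where the cut-off
function is `-1`, or outside, where it is `0` (`hasCirculation_strain`).

For the energy, each dyadic annulus costs of order `τ² ε²`, because the deviation from a rotation is
of order `τ ε / r` on an area of order `r²`; a core also costs of order `τ² ε²`. There are of order
`L / ℓᵢ` squares of `1 + log₂ (ℓᵢ / (λ ε))` annuli, and the sum of these numbers over the two strips
is a multiple of the right-hand side (`bound_eq_sum`, `energy_strain_le`).

The sign conditions hold after reversing the generators suitably, which changes neither the lattice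
nor the energy (`exists_angles`, `admissible_withAngles`).
-/


noncomputable section

namespace GrainBoundary

open MeasureTheory Set

/-! ### Calculus on half-strips of the plane -/

/-- The map `(x, t) ↦ (x, m x + q + t)`, which straightens the line of slope `m`. -/
def shear (m q : ℝ) (z : ℝ × ℝ) : Plane := !₂[z.1, m * z.1 + q + z.2]

@[simp] lemma shear_zero (m q : ℝ) (z : ℝ × ℝ) : shear m q z 0 = z.1 := rfl

@[simp] lemma shear_one (m q : ℝ) (z : ℝ × ℝ) : shear m q z 1 = m * z.1 + q + z.2 := rfl

lemma plane_ext {x y : Plane} (h0 : x 0 = y 0) (h1 : x 1 = y 1) : x = y := by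
  ext i
  fin_cases i
  · exact h0
  · exact h1

lemma continuous_shear (m q : ℝ) : Continuous (shear m q) := by
  unfold shear
  refine (PiLp.continuous_toLp 2 _).comp (continuous_pi fun i => ?_)
  fin_cases i
  · exact continuous_fst
  · change Continuous fun z : ℝ × ℝ => m * z.1 + q + z.2
    fun_prop

lemma measurePreserving_shear (m q : ℝ) : MeasurePreserving (shear m q) := by
  have h1 : MeasurePreserving (fun z : ℝ × ℝ => (z.1, m * z.1 + q + z.2)) := by
    refine (MeasurePreserving.id volume).skew_product (g := fun x t => m * x + q + t) ?_ ?_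
    · exact Measurable.add (by fun_prop) measurable_snd
    · exact ae_of_all _ fun x => (measurePreserving_add_left volume (m * x + q)).map_eq
  have h2 := (volume_preserving_finTwoArrow ℝ).symm
  have h3 := PiLp.volume_preserving_toLp (Fin 2)
  exact h3.comp (h2.comp h1)

lemma isClosedEmbedding_shear (m q : ℝ) :
    Topology.IsClosedEmbedding (shear m q) := by
  refine Function.LeftInverse.isClosedEmbedding
    (f := fun x : Plane => (x 0, x 1 - (m * x 0 + q))) ?_ ?_ (continuous_shear m q)
  · intro z
    simp
  · fun_prop

lemma measurableEmbedding_shear (m q : ℝ) : MeasurableEmbedding (shear m q) :=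
  (isClosedEmbedding_shear m q).measurableEmbedding

lemma ae_fst_ne (c : ℝ) : ∀ᵐ x : Plane, x 0 ≠ c := by
  rw [← (measurePreserving_shear 0 0).map_eq,
    (measurableEmbedding_shear 0 0).ae_map_iff]
  have : ∀ᵐ x : ℝ, x ≠ c := Measure.ae_ne volume c
  exact Measure.quasiMeasurePreserving_fst.ae this

lemma ae_snd_ne (m q : ℝ) : ∀ᵐ x : Plane, x 1 ≠ m * x 0 + q := by
  rw [← (measurePreserving_shear m q).map_eq,
    (measurableEmbedding_shear m q).ae_map_iff]
  have : ∀ᵐ x : ℝ, x ≠ 0 := Measure.ae_ne volume 0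
  filter_upwards [Measure.quasiMeasurePreserving_snd.ae this] with z hz
  simpa using hz

/-- The open half-strip over the interval `(a, b)` and below the line `x₂ = m x₁ + q`. -/
def halfStrip (a b m q : ℝ) : Set Plane := {x | a < x 0 ∧ x 0 < b ∧ x 1 < m * x 0 + q}

lemma isOpen_halfStrip (a b m q : ℝ) : IsOpen (halfStrip a b m q) := by
  have h0 : Continuous fun x : Plane => x 0 := by fun_prop
  have h1 : Continuous fun x : Plane => x 1 := by fun_prop
  exact (isOpen_lt continuous_const h0).inter
    ((isOpen_lt h0 continuous_const).inter (isOpen_lt h1 (by fun_prop)))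

lemma measurableSet_halfStrip (a b m q : ℝ) : MeasurableSet (halfStrip a b m q) :=
  (isOpen_halfStrip a b m q).measurableSet

lemma preimage_halfStrip (a b m q : ℝ) :
    shear m q ⁻¹' halfStrip a b m q = Ioo a b ×ˢ Iio 0 := by
  ext z
  simp [halfStrip, and_assoc]

lemma setIntegral_halfStrip (a b m q : ℝ) (g : Plane → ℝ) :
    ∫ x in halfStrip a b m q, g x = ∫ z in Ioo a b ×ˢ Iio (0 : ℝ), g (shear m q z) := by
  rw [← preimage_halfStrip a b m q]
  exact ((measurePreserving_shear m q).setIntegral_preimage_emb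
    (measurableEmbedding_shear m q) g _).symm

/-- The integral of `χ` over the vertical half-line below `(x, t)`. -/
def lineIntegral (χ : Plane → ℝ) (x t : ℝ) : ℝ := ∫ y in Iio t, χ !₂[x, y]

lemma fderiv_eq_partialD (χ : Plane → ℝ) (x : Plane) (u v : ℝ) :
    fderiv ℝ χ x !₂[u, v] = u * partialD 0 χ x + v * partialD 1 χ x := by
  have : (!₂[u, v] : Plane) =
      u • EuclideanSpace.single 0 1 + v • EuclideanSpace.single 1 1 := by
    apply plane_ext <;> simp
  rw [this, map_add, map_smul, map_smul]
  rfl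

lemma hasDerivAt_line {χ : Plane → ℝ} (hχ : ContDiff ℝ ∞ χ) (u v a b t : ℝ) :
    HasDerivAt (fun t : ℝ => χ !₂[a + u * t, b + v * t])
      (u * partialD 0 χ !₂[a + u * t, b + v * t] + v * partialD 1 χ !₂[a + u * t, b + v * t]) t := by
  rw [← fderiv_eq_partialD]
  have hc : HasDerivAt (fun t : ℝ => (!₂[a, b] : Plane) + t • !₂[u, v]) (!₂[u, v] : Plane) t := by
    simpa using ((hasDerivAt_id t).smul_const (!₂[u, v] : Plane)).const_add (!₂[a, b] : Plane)
  have he : (fun t : ℝ => (!₂[a, b] : Plane) + t • !₂[u, v]) =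
      fun t : ℝ => !₂[a + u * t, b + v * t] := by
    funext t
    apply plane_ext <;> simp [mul_comm]
  rw [he] at hc
  have hd : HasFDerivAt χ (fderiv ℝ χ !₂[a + u * t, b + v * t]) !₂[a + u * t, b + v * t] :=
    ((hχ.differentiable (by simp)) _).hasFDerivAt
  exact hd.comp_hasDerivAt t hc

lemma continuous_partialD {χ : Plane → ℝ} (hχ : ContDiff ℝ ∞ χ) (j : Fin 2) :
    Continuous (partialD j χ) :=
  (hχ.continuous_fderiv (by simp)).clm_apply continuous_const

lemma tsupport_partialD_subset (χ : Plane → ℝ) (j : Fin 2) :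
    tsupport (partialD j χ) ⊆ tsupport χ := by
  refine closure_minimal (fun x hx => ?_) (isClosed_tsupport χ)
  by_contra h
  apply hx
  have : fderiv ℝ χ x = 0 := by
    by_contra h'
    exact h (support_fderiv_subset ℝ (f := χ) h')
  simp [partialD, this]

lemma hasCompactSupport_partialD {χ : Plane → ℝ} (hc : HasCompactSupport χ) (j : Fin 2) :
    HasCompactSupport (partialD j χ) :=
  hc.mono' ((subset_tsupport _).trans (tsupport_partialD_subset χ j))

lemma integrable_partialD {χ : Plane → ℝ} (hχ : ContDiff ℝ ∞ χ) (hc : HasCompactSupport χ)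
    (j : Fin 2) : Integrable (partialD j χ) :=
  (continuous_partialD hχ j).integrable_of_hasCompactSupport (hasCompactSupport_partialD hc j)

lemma continuous_vertical (x : ℝ) : Continuous fun t : ℝ => (!₂[x, t] : Plane) := by
  refine (PiLp.continuous_toLp 2 _).comp (continuous_pi fun i => ?_)
  fin_cases i
  · exact continuous_const
  · exact continuous_id

lemma isClosedEmbedding_vertical (x : ℝ) :
    Topology.IsClosedEmbedding fun t : ℝ => (!₂[x, t] : Plane) :=
  Function.LeftInverse.isClosedEmbedding (f := fun z : Plane => z 1) (fun _ => rfl)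
    (by fun_prop) (continuous_vertical x)

lemma integrable_vertical {χ : Plane → ℝ} (hχ : Continuous χ) (hc : HasCompactSupport χ) (x : ℝ) :
    Integrable fun t : ℝ => χ !₂[x, t] :=
  (hχ.comp (continuous_vertical x)).integrable_of_hasCompactSupport
    (hc.comp_isClosedEmbedding (isClosedEmbedding_vertical x))

lemma lineIntegral_eq_shift (χ : Plane → ℝ) (x t : ℝ) :
    lineIntegral χ x t = ∫ y in Iio (0 : ℝ), χ !₂[x, t + y] := by
  have h := (measurePreserving_add_left volume t).setIntegral_preimage_emb
    (measurableEmbedding_addLeft t) (fun y => χ !₂[x, y]) (Iio t)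
  rw [lineIntegral, ← h]
  simp

lemma lineIntegral_sub {χ : Plane → ℝ} (hχ : Continuous χ) (hc : HasCompactSupport χ)
    (x : ℝ) {s t c : ℝ} (hst : s ≤ t) (h : ∀ y ∈ Icc s t, χ !₂[x, y] = c) :
    lineIntegral χ x t - lineIntegral χ x s = (t - s) * c := by
  have hi := integrable_vertical hχ hc x
  have hd : Iio t = Iio s ∪ Ico s t := (Iio_union_Ico_eq_Iio hst).symm
  rw [lineIntegral, lineIntegral, hd, setIntegral_union _ measurableSet_Ico hi.integrableOn
    hi.integrableOn, setIntegral_congr_fun measurableSet_Ico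
      (fun y hy => h y (Ico_subset_Icc_self hy))]
  · simp [hst]
  · exact Set.disjoint_left.2 fun y hy hy' => absurd hy'.1 (not_le.2 hy)

lemma lineIntegral_eq_zero {χ : Plane → ℝ} {x t : ℝ} (h : ∀ y ≤ t, χ !₂[x, y] = 0) :
    lineIntegral χ x t = 0 := by
  rw [lineIntegral]
  exact setIntegral_eq_zero_of_forall_eq_zero fun y hy => h y (le_of_lt hy)

/-- Green's formula on a half-strip for the derivative tangential to its upper edge: in the
coordinates of `shear` this derivative is a partial derivative, so only the two vertical edges
contribute. -/
lemma setIntegral_halfStrip_tangential {χ : Plane → ℝ} (hχ : ContDiff ℝ ∞ χ)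
    (hc : HasCompactSupport χ) {a b : ℝ} (hab : a ≤ b) (m q : ℝ) :
    ∫ x in halfStrip a b m q, (partialD 0 χ x + m * partialD 1 χ x) =
      lineIntegral χ b (m * b + q) - lineIntegral χ a (m * a + q) := by
  set g : Plane → ℝ := fun x => partialD 0 χ x + m * partialD 1 χ x with hg
  have hgi : Integrable (fun z : ℝ × ℝ => g (shear m q z)) :=
    (measurePreserving_shear m q).integrable_comp_of_integrable
      ((integrable_partialD hχ hc 0).add ((integrable_partialD hχ hc 1).const_mul m))
  have hgc : Continuous fun z : ℝ × ℝ => g (shear m q z) :=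
    ((continuous_partialD hχ 0).add (continuous_const.mul (continuous_partialD hχ 1))).comp
      (continuous_shear m q)
  rw [setIntegral_halfStrip, Measure.volume_eq_prod, ← Measure.prod_restrict,
    integral_prod_symm _ (by
      rw [Measure.prod_restrict]
      exact hgi.integrableOn)]
  have hin (t : ℝ) : ∫ x in Ioo a b, g (shear m q (x, t)) =
      χ !₂[b, (m * b + q) + t] - χ !₂[a, (m * a + q) + t] := by
    rw [← integral_Ioc_eq_integral_Ioo, ← intervalIntegral.integral_of_le hab]
    have hd : ∀ x ∈ uIcc a b, HasDerivAt (fun x : ℝ => χ !₂[x, m * x + q + t])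
        (g (shear m q (x, t))) x := by
      intro x _
      have := hasDerivAt_line hχ 1 m 0 (q + t) x
      simp only [zero_add, one_mul] at this
      have e : ∀ x : ℝ, q + t + m * x = m * x + q + t := fun x => by ring
      simp only [e] at this
      exact this
    exact intervalIntegral.integral_eq_sub_of_hasDerivAt hd
      ((hgc.comp (by fun_prop : Continuous fun x : ℝ => (x, t))).intervalIntegrable _ _)
  rw [integral_congr_ae (ae_of_all _ hin)]
  have hs (x t : ℝ) : IntegrableOn (fun y : ℝ => χ !₂[x, t + y]) (Iio 0) :=
    ((integrable_vertical hχ.continuous hc x).comp_add_left t).integrableOn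
  rw [integral_sub (hs _ _) (hs _ _), lineIntegral_eq_shift, lineIntegral_eq_shift]

/-- The vertical derivative integrated over a half-strip with horizontal edge on which `χ` is
constant. -/
lemma setIntegral_halfStrip_vertical {χ : Plane → ℝ} (hχ : ContDiff ℝ ∞ χ)
    (hc : HasCompactSupport χ) {a b : ℝ} (hab : a ≤ b) {q c : ℝ}
    (h : ∀ x ∈ Ioo a b, χ !₂[x, q] = c) :
    ∫ x in halfStrip a b 0 q, partialD 1 χ x = (b - a) * c := by
  have hgi : Integrable (fun z : ℝ × ℝ => partialD 1 χ (shear 0 q z)) :=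
    (measurePreserving_shear 0 q).integrable_comp_of_integrable (integrable_partialD hχ hc 1)
  rw [setIntegral_halfStrip, Measure.volume_eq_prod, setIntegral_prod _ hgi.integrableOn]
  have hin (x : ℝ) : ∫ t in Iio (0 : ℝ), partialD 1 χ (shear 0 q (x, t)) = χ !₂[x, q] := by
    rw [← integral_Iic_eq_integral_Iio]
    have hl : ContDiff ℝ 1 fun t : ℝ => (!₂[x, q + t] : Plane) := by
      have : ContDiff ℝ 1 fun t : ℝ => ((!₂[x, q] : Plane) + t • !₂[0, 1]) := by fun_prop
      convert! this using 2 with t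
      apply plane_ext <;> simp
    have hf : ContDiff ℝ 1 fun t : ℝ => χ !₂[x, q + t] := (hχ.of_le (by simp)).comp hl
    have hs : HasCompactSupport fun t : ℝ => χ !₂[x, q + t] := by
      refine hc.comp_isClosedEmbedding (g := fun t : ℝ => (!₂[x, q + t] : Plane)) ?_
      exact Function.LeftInverse.isClosedEmbedding (f := fun z : Plane => z 1 - q)
        (fun t => by simp) (by fun_prop) hl.continuous
    have hd (t : ℝ) : deriv (fun t : ℝ => χ !₂[x, q + t]) t = partialD 1 χ (shear 0 q (x, t)) := by
      have := (hasDerivAt_line hχ 0 1 x q t).deriv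
      simp only [zero_mul, add_zero, one_mul, zero_add] at this
      simpa [shear] using this
    have := hs.integral_Iic_deriv_eq hf 0
    simpa [hd] using this
  simp only [hin]
  rw [setIntegral_congr_fun measurableSet_Ioo h]
  simp [hab]

/-! ### Parameters of the construction -/

lemma sgn_eq (i : Fin 2) : sgn i = -1 ∨ sgn i = 1 := by
  fin_cases i
  · exact Or.inl rfl
  · exact Or.inr rfl

lemma sgn_mul_self (i : Fin 2) : sgn i * sgn i = 1 := by
  rcases sgn_eq i with h | h <;> rw [h] <;> norm_num

lemma sgn_injective : Function.Injective sgn := by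
  intro i j h
  fin_cases i <;> fin_cases j <;> first | rfl | (norm_num [sgn] at h)

section Parameters

variable {p : Params} (hS : Standing p) (hC : SignCond p)

include hS in
lemma sin_theta_pos : 0 < Real.sin p.θ :=
  Real.sin_pos_of_pos_of_lt_pi hS.2.2.2.1 (hS.2.2.2.2.1.trans_lt (by linarith [Real.pi_pos]))

include hS in
lemma lam_mul_eps_pos : 0 < p.lam * p.ε :=
  mul_pos (hS.2.2.2.2.2.1.trans hS.2.2.2.2.2.2.1) hS.2.2.1

include hS in
lemma tau_mul_eps_pos : 0 < p.τ * p.ε := mul_pos hS.2.2.2.2.2.1 hS.2.2.1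

include hC in
lemma sin_ne_zero : Real.sin p.φ ≠ 0 ∧ Real.sin p.η ≠ 0 ∧ Real.sin (p.φ - p.η) ≠ 0 := by
  refine ⟨fun h => ?_, fun h => ?_, fun h => ?_⟩
  · have := hC.2
    simp [h] at this
  · have := hC.1
    simp [h] at this
  · have := hC.1
    simp [h] at this

include hS hC in
lemma spacing_pos (i : Fin 2) : 0 < spacing p i := by
  have hs := sin_theta_pos hS
  have ht := tau_mul_eps_pos hS
  fin_cases i
  · change 0 < -(p.τ * p.ε / 4) * (Real.sin (p.φ - p.η) / (Real.sin p.θ * Real.sin p.η))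
    rw [mul_comm (Real.sin p.θ), ← div_div]
    exact mul_pos_of_neg_of_neg (by linarith) (div_neg_of_neg_of_pos hC.1 hs)
  · change 0 < (p.τ * p.ε / 4) * (Real.sin (p.φ - p.η) / (Real.sin p.θ * Real.sin p.φ))
    rw [mul_comm (Real.sin p.θ), ← div_div]
    exact mul_pos (by linarith) (div_pos hC.2 hs)

include hS hC in
lemma lam_mul_eps_le_spacing (i : Fin 2) : p.lam * p.ε ≤ spacing p i := by
  have := hS.2.2.2.2.2.2.2.1 i
  rwa [abs_of_pos (spacing_pos hS hC i)] at this

include hS hC in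
lemma layer_add_spacing_le (i : Fin 2) : p.l + 2 * spacing p i ≤ p.L := by
  have := hS.2.2.2.2.2.2.2.2 i
  rwa [abs_of_pos (spacing_pos hS hC i)] at this

include hS hC in
lemma radius_pos (i : Fin 2) (n : ℕ) : 0 < radius p i n := by
  have := spacing_pos hS hC i
  unfold radius
  positivity

lemma radius_eq_two_mul (p : Params) (i : Fin 2) {n : ℕ} (hn : 1 ≤ n) :
    radius p i n = 2 * radius p i (n - 1) := by
  obtain ⟨m, rfl⟩ : ∃ m, n = m + 1 := ⟨n - 1, by omega⟩
  simp only [radius, Nat.add_sub_cancel, pow_succ]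
  ring

lemma radius_nbar (p : Params) (i : Fin 2) : radius p i (nbar p i) = spacing p i := by
  unfold radius
  field_simp

include hS hC in
lemma radius_mono (i : Fin 2) : Monotone (radius p i) := by
  intro m n h
  have := spacing_pos hS hC i
  unfold radius
  gcongr
  norm_num

include hS hC in
lemma radius_le_spacing (i : Fin 2) {n : ℕ} (h : n ≤ nbar p i) : radius p i n ≤ spacing p i := by
  rw [← radius_nbar p i]
  exact radius_mono hS hC i h

include hS hC in
lemma logb_nonneg (i : Fin 2) : 0 ≤ Real.logb 2 (spacing p i / (p.lam * p.ε)) :=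
  Real.logb_nonneg (by norm_num)
    ((one_le_div (lam_mul_eps_pos hS)).2 (lam_mul_eps_le_spacing hS hC i))

include hS hC in
lemma radius_zero_lt (i : Fin 2) : radius p i 0 < 2 * (p.lam * p.ε) := by
  have hl := lam_mul_eps_pos hS
  have hq : 0 < spacing p i / (p.lam * p.ε) := div_pos (spacing_pos hS hC i) hl
  have h := Nat.lt_floor_add_one (Real.logb 2 (spacing p i / (p.lam * p.ε)))
  rw [Real.logb_lt_iff_lt_rpow (by norm_num) hq] at h
  change _ < (2 : ℝ) ^ ((nbar p i : ℝ) + 1) at h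
  rw [Real.rpow_add (by norm_num), Real.rpow_natCast, Real.rpow_one, div_lt_iff₀ hl] at h
  unfold radius
  rw [pow_zero, one_mul, div_lt_iff₀ (by positivity)]
  linarith

/-- The balance of Burgers vectors on the interface: the density `1 / (2 ℓᵢ)` of dislocations of
type `i` makes up for the jump of the rotations across the line `x₁ = 0`. -/
lemma burgers_balance (hS : Standing p) (hC : SignCond p) (a : Fin 2) :
    ∑ i, p.τ * p.ε * gen p i a / (2 * spacing p i) = rot (-p.θ) a 1 - rot p.θ a 1 := by
  have hs := (sin_theta_pos hS).ne'
  obtain ⟨h1, h2, h3⟩ := sin_ne_zero hC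
  have ht := hS.2.2.2.2.2.1.ne'
  have he := hS.2.2.1.ne'
  rw [Fin.sum_univ_two]
  have e0 : p.τ * p.ε / (2 * spacing p 0) =
      -2 * Real.sin p.θ * Real.sin p.η / Real.sin (p.φ - p.η) := by
    change p.τ * p.ε / (2 * (-(p.τ * p.ε / 4) *
      (Real.sin (p.φ - p.η) / (Real.sin p.θ * Real.sin p.η)))) = _
    field_simp
    norm_num
  have e1 : p.τ * p.ε / (2 * spacing p 1) =
      2 * Real.sin p.θ * Real.sin p.φ / Real.sin (p.φ - p.η) := by
    change p.τ * p.ε / (2 * ((p.τ * p.ε / 4) *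
      (Real.sin (p.φ - p.η) / (Real.sin p.θ * Real.sin p.φ)))) = _
    field_simp
    norm_num
  have e (i : Fin 2) : p.τ * p.ε * gen p i a / (2 * spacing p i) =
      p.τ * p.ε / (2 * spacing p i) * gen p i a := mul_div_right_comm _ _ _
  rw [e, e, e0, e1]
  fin_cases a
  · simp only [gen, angle, unitVec, rot, Matrix.cons_val_zero, Matrix.cons_val_one,
      Fin.zero_eta, PiLp.toLp_apply, Matrix.of_apply, Real.sin_neg]
    simp
    field_simp
    rw [Real.sin_sub]
    ring
  · simp only [gen, angle, unitVec, rot, Matrix.cons_val_zero, Matrix.cons_val_one,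
      PiLp.toLp_apply, Matrix.of_apply, Real.cos_neg]
    simp
    field_simp
    ring

end Parameters

/-! ### Triangles and cores in local coordinates -/

/-- The distance coordinate from the axis of strip `i`, increasing towards the interface. -/
def locX (p : Params) (i : Fin 2) (x : Plane) : ℝ := spacing p i - sgn i * x 0

/-- The vertical coordinate relative to the centre of the `k`-th square of strip `i`. -/
def locY (p : Params) (i : Fin 2) (k : ℕ) (x : Plane) : ℝ := x 1 + (2 * (k : ℝ) - 1) * spacing p i

lemma center_zero (p : Params) (i : Fin 2) (k : ℕ) : center p i k 0 = sgn i * spacing p i := rfl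

lemma center_one (p : Params) (i : Fin 2) (k : ℕ) :
    center p i k 1 = -(2 * (k : ℝ) - 1) * spacing p i := rfl

lemma fst_eq_locX (p : Params) (i : Fin 2) (x : Plane) :
    x 0 = sgn i * spacing p i - sgn i * locX p i x := by
  have := sgn_mul_self i
  unfold locX
  linear_combination (-x 0) * this

lemma snd_eq_locY (p : Params) (i : Fin 2) (k : ℕ) (x : Plane) :
    x 1 = -(2 * (k : ℝ) - 1) * spacing p i + locY p i k x := by
  unfold locY
  ring

lemma abs_fst_sub_center (p : Params) (i : Fin 2) (k : ℕ) (x : Plane) :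
    |x 0 - center p i k 0| = |locX p i x| := by
  rw [center_zero, fst_eq_locX p i x]
  rcases sgn_eq i with h | h <;> simp [h]

lemma snd_sub_center (p : Params) (i : Fin 2) (k : ℕ) (x : Plane) :
    x 1 - center p i k 1 = locY p i k x := by
  rw [center_one, locY]
  ring

lemma mem_coreSq {p : Params} {i : Fin 2} {k : ℕ} {x : Plane} :
    x ∈ coreSq p i k ↔ |locX p i x| ≤ radius p i 0 ∧ |locY p i k x| ≤ radius p i 0 := by
  rw [coreSq, mem_ofPred_eq, abs_fst_sub_center, snd_sub_center, max_le_iff]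

lemma coreBdry_subset_coreSq (p : Params) (i : Fin 2) (k : ℕ) : coreBdry p i k ⊆ coreSq p i k :=
  fun _ hx => le_of_eq hx

lemma convex_setOf_le (a b c : ℝ) : Convex ℝ {x : Plane | a * x 0 + b * x 1 ≤ c} := by
  intro x hx y hy s t hs ht hst
  simp only [mem_ofPred_eq, PiLp.add_apply, PiLp.smul_apply, smul_eq_mul] at *
  have h1 := mul_le_mul_of_nonneg_left hx hs
  have h2 := mul_le_mul_of_nonneg_left hy ht
  have h3 : c = s * c + t * c := by rw [← add_mul, hst, one_mul]
  linarith

lemma mem_tri_false {p : Params} {i : Fin 2} (k : ℕ) {n : ℕ} {x : Plane} (hn : 1 ≤ n)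
    (hr : 0 < radius p i (n - 1)) :
    x ∈ tri p i k n false ↔ radius p i (n - 1) ≤ locX p i x ∧ locY p i k x ≤ locX p i x ∧
      3 * locX p i x - 4 * radius p i (n - 1) ≤ locY p i k x := by
  have h2 := radius_eq_two_mul p i hn
  set r := radius p i (n - 1) with hr_def
  have hs := sgn_mul_self i
  constructor
  · intro hx
    have hsub : tri p i k n false ⊆
        {x | sgn i * x 0 + 0 * x 1 ≤ spacing p i - r} ∩
        ({x | sgn i * x 0 + 1 * x 1 ≤ spacing p i - (2 * (k : ℝ) - 1) * spacing p i} ∩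
        {x | (-3 * sgn i) * x 0 + (-1) * x 1 ≤
          4 * r - 3 * spacing p i + (2 * (k : ℝ) - 1) * spacing p i}) := by
      refine convexHull_min ?_ ((convex_setOf_le _ _ _).inter
        ((convex_setOf_le _ _ _).inter (convex_setOf_le _ _ _)))
      rintro _ ⟨j, rfl⟩
      fin_cases j <;> simp [triVertex, h2, ← hr_def, center] <;>
        refine ⟨?_, ?_, ?_⟩ <;> rcases sgn_eq i with h | h <;> rw [h] <;> linarith
    obtain ⟨h1, h3, h4⟩ := hsub hx
    simp only [mem_ofPred_eq] at h1 h3 h4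
    simp only [locX, locY]
    refine ⟨by linarith, by linarith, by linarith⟩
  · rintro ⟨h1, h3, h4⟩
    set X := locX p i x with hX
    set Y := locY p i k x with hY
    -- the weights are the barycentric coordinates of `x`
    have hmem := (convex_convexHull ℝ (range (triVertex p i k n false))).sum_mem
      (t := Finset.univ) (w := ![(X - Y) / (2 * r), (X - r) / r, (Y - 3 * X + 4 * r) / (2 * r)])
      (z := triVertex p i k n false) ?_ ?_ (fun j _ => subset_convexHull _ _ ⟨j, rfl⟩)
    · convert! hmem using 1
      simp only [Fin.sum_univ_three]
      apply plane_ext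
      · rw [fst_eq_locX p i x, ← hX]
        simp [triVertex, h2, ← hr_def, center_zero]
        field_simp
        ring
      · rw [snd_eq_locY p i k x, ← hY]
        simp [triVertex, h2, ← hr_def, center_one]
        field_simp
        ring
    · intro j _
      fin_cases j
      · exact div_nonneg (by linarith) (by linarith)
      · exact div_nonneg (by linarith) (by linarith)
      · exact div_nonneg (by linarith) (by linarith)
    · simp [Fin.sum_univ_three]
      field_simp
      ring

lemma mem_tri_true {p : Params} {i : Fin 2} (k : ℕ) {n : ℕ} {x : Plane} (hn : 1 ≤ n)
    (hr : 0 < radius p i (n - 1)) :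
    x ∈ tri p i k n true ↔ locX p i x ≤ 2 * radius p i (n - 1) ∧ -locX p i x ≤ locY p i k x ∧
      locY p i k x ≤ 3 * locX p i x - 4 * radius p i (n - 1) := by
  have h2 := radius_eq_two_mul p i hn
  set r := radius p i (n - 1) with hr_def
  have hs := sgn_mul_self i
  constructor
  · intro hx
    have hsub : tri p i k n true ⊆
        {x | (-sgn i) * x 0 + 0 * x 1 ≤ 2 * r - spacing p i} ∩
        ({x | sgn i * x 0 + (-1) * x 1 ≤ spacing p i + (2 * (k : ℝ) - 1) * spacing p i} ∩
        {x | (3 * sgn i) * x 0 + 1 * x 1 ≤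
          3 * spacing p i - 4 * r - (2 * (k : ℝ) - 1) * spacing p i}) := by
      refine convexHull_min ?_ ((convex_setOf_le _ _ _).inter
        ((convex_setOf_le _ _ _).inter (convex_setOf_le _ _ _)))
      rintro _ ⟨j, rfl⟩
      fin_cases j <;> simp [triVertex, h2, ← hr_def, center] <;>
        refine ⟨?_, ?_, ?_⟩ <;> rcases sgn_eq i with h | h <;> rw [h] <;> linarith
    obtain ⟨h1, h3, h4⟩ := hsub hx
    simp only [mem_ofPred_eq] at h1 h3 h4
    simp only [locX, locY]
    refine ⟨by linarith, by linarith, by linarith⟩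
  · rintro ⟨h1, h3, h4⟩
    set X := locX p i x with hX
    set Y := locY p i k x with hY
    -- the weights are the barycentric coordinates of `x`
    have hmem := (convex_convexHull ℝ (range (triVertex p i k n true))).sum_mem
      (t := Finset.univ)
      (w := ![(2 * r - X) / r, (3 * X - 4 * r - Y) / (4 * r), (X + Y) / (4 * r)])
      (z := triVertex p i k n true) ?_ ?_ (fun j _ => subset_convexHull _ _ ⟨j, rfl⟩)
    · convert! hmem using 1
      simp only [Fin.sum_univ_three]
      apply plane_ext
      · rw [fst_eq_locX p i x, ← hX]
        simp [triVertex, h2, ← hr_def, center_zero]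
        field_simp
        ring
      · rw [snd_eq_locY p i k x, ← hY]
        simp [triVertex, h2, ← hr_def, center_one]
        field_simp
        ring
    · intro j _
      fin_cases j
      · exact div_nonneg (by linarith) (by linarith)
      · exact div_nonneg (by linarith) (by linarith)
      · exact div_nonneg (by linarith) (by linarith)
    · simp [Fin.sum_univ_three]
      field_simp
      ring

/-- The interpolation is exact on affine maps. -/
lemma interpGrad_eq {q v : Fin 3 → Plane} {G : Mat}
    (hdet : (q 1 - q 0) 0 * (q 2 - q 0) 1 - (q 2 - q 0) 0 * (q 1 - q 0) 1 ≠ 0)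
    (h1 : ∀ a, (v 1 - v 0) a = G a 0 * (q 1 - q 0) 0 + G a 1 * (q 1 - q 0) 1)
    (h2 : ∀ a, (v 2 - v 0) a = G a 0 * (q 2 - q 0) 0 + G a 1 * (q 2 - q 0) 1) :
    interpGrad q v = G := by
  unfold interpGrad
  have hm : !![(v 1 - v 0) 0, (v 2 - v 0) 0; (v 1 - v 0) 1, (v 2 - v 0) 1] =
      G * !![(q 1 - q 0) 0, (q 2 - q 0) 0; (q 1 - q 0) 1, (q 2 - q 0) 1] := by
    ext a b
    fin_cases b
    · fin_cases a <;> simp [Matrix.mul_apply, Fin.sum_univ_two, -PiLp.sub_apply, h1]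
    · fin_cases a <;> simp [Matrix.mul_apply, Fin.sum_univ_two, -PiLp.sub_apply, h2]
  rw [hm, Matrix.mul_assoc, Matrix.mul_nonsing_inv _ (by
    rw [Matrix.det_fin_two_of]
    exact hdet.isUnit), Matrix.mul_one]

/-- The gradient of the scalar profile of the displacement (in units of the Burgers vector) on the
two triangles of the annulus of inner radius `r`. -/
def triCov (i : Fin 2) (r : ℝ) : Bool → Fin 2 → ℝ
  | false => ![-sgn i / (2 * r), -1 / (2 * r)]
  | true => ![sgn i / (4 * r), -1 / (4 * r)]

lemma triValue_sub_apply (p : Params) (i : Fin 2) (k n : ℕ) (z : Bool) (j : Fin 3) (a : Fin 2) :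
    (triValue p i k n z j - triValue p i k n z 0) a =
      rot (sgn i * p.θ) a 0 * (triVertex p i k n z j - triVertex p i k n z 0) 0 +
      rot (sgn i * p.θ) a 1 * (triVertex p i k n z j - triVertex p i k n z 0) 1 +
      -sgn i * (p.τ * p.ε) * gen p i a * (triShift z j - triShift z 0) := by
  simp only [triValue, PiLp.sub_apply, PiLp.add_apply, PiLp.smul_apply,
    Matrix.mulVec, dotProduct, Fin.sum_univ_two, smul_eq_mul]
  ring

/-- The strain on a triangle is the rotation of its half plus the rank-one term built from the Burgers
vector and the gradient of the scalar profile. -/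
lemma triGrad_apply {p : Params} {i : Fin 2} (k : ℕ) {n : ℕ} (hn : 1 ≤ n)
    (hr : 0 < radius p i (n - 1)) (z : Bool) (a b : Fin 2) :
    triGrad p i k n z a b = rot (sgn i * p.θ) a b +
      -sgn i * (p.τ * p.ε) * gen p i a * triCov i (radius p i (n - 1)) z b := by
  have h2 := radius_eq_two_mul p i hn
  have hs := sgn_mul_self i
  have key : triGrad p i k n z = Matrix.of fun a b => rot (sgn i * p.θ) a b +
      -sgn i * (p.τ * p.ε) * gen p i a * triCov i (radius p i (n - 1)) z b := by
    set r := radius p i (n - 1) with hr_def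
    have hs0 : sgn i ≠ 0 := by
      rcases sgn_eq i with h | h <;> rw [h] <;> norm_num
    have d (j : Fin 3) : (triShift z j - triShift z 0) =
        triCov i r z 0 * (triVertex p i k n z j - triVertex p i k n z 0) 0 +
        triCov i r z 1 * (triVertex p i k n z j - triVertex p i k n z 0) 1 := by
      cases z <;> fin_cases j <;> simp [triVertex, triShift, triCov, h2, ← hr_def] <;>
        rcases sgn_eq i with h | h <;> (try simp only [h]) <;> field_simp <;> norm_num
    apply interpGrad_eq
    · cases z <;> simp [triVertex, h2, ← hr_def] <;> rcases sgn_eq i with h | h <;> rw [h] <;>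
        first | exact ⟨fun h => by linarith, hr.ne'⟩ | (intro h; nlinarith [mul_pos hr hr])
    all_goals
      intro a
      rw [triValue_sub_apply, d]
      simp only [Matrix.of_apply]
      ring
  rw [key]
  rfl

/-! ### The strain as a sum over almost disjoint pieces -/

/-- A point off all the lines that carry an edge of a piece of the construction. -/
def IsGeneric (p : Params) (x : Plane) : Prop :=
  x 0 ≠ 0 ∧ ∀ (i : Fin 2) (k n : ℕ), locX p i x ≠ radius p i n ∧ locX p i x ≠ -radius p i n ∧
    locY p i k x ≠ radius p i n ∧ locY p i k x ≠ -radius p i n ∧ locY p i k x ≠ locX p i x ∧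
    locY p i k x ≠ -locX p i x ∧ locY p i k x ≠ 3 * locX p i x - 4 * radius p i n

lemma ae_locX_ne (p : Params) (i : Fin 2) (c : ℝ) : ∀ᵐ x : Plane, locX p i x ≠ c := by
  filter_upwards [ae_fst_ne (sgn i * spacing p i - sgn i * c)] with x hx h
  exact hx (by rw [fst_eq_locX p i x, h])

lemma ae_locY_ne (p : Params) (i : Fin 2) (k : ℕ) (m q : ℝ) :
    ∀ᵐ x : Plane, locY p i k x ≠ m * locX p i x + q := by
  filter_upwards [ae_snd_ne (-(m * sgn i))
    (m * spacing p i + q - (2 * (k : ℝ) - 1) * spacing p i)] with x hx h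
  apply hx
  rw [snd_eq_locY p i k x, h, locX]
  ring

lemma ae_isGeneric (p : Params) : ∀ᵐ x : Plane, IsGeneric p x := by
  refine (ae_fst_ne 0).and ?_
  simp only [ae_all_iff]
  intro i k n
  filter_upwards [ae_locX_ne p i (radius p i n), ae_locX_ne p i (-radius p i n),
    ae_locY_ne p i k 0 (radius p i n), ae_locY_ne p i k 0 (-radius p i n),
    ae_locY_ne p i k 1 0, ae_locY_ne p i k (-1) 0, ae_locY_ne p i k 3 (-(4 * radius p i n))]
    with x h1 h2 h3 h4 h5 h6 h7
  simp only [zero_mul, zero_add, one_mul, add_zero, neg_mul, ← sub_eq_add_neg, zero_sub] at h3 h4 h5 h6 h7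
  exact ⟨h1, h2, h3, h4, h5, h6, h7⟩

/-- The constant rotations in the two halves of the plane. -/
def baseField (p : Params) (x : Plane) : Mat := if x 0 < 0 then rot (-p.θ) else rot p.θ

/-- The deviation of the strain from the rotation in the `k`-th square of strip `i`. -/
def squareField (p : Params) (i : Fin 2) (k : ℕ) (x : Plane) : Mat :=
  (coreSq p i k).indicator (fun _ => 1 - rot (sgn i * p.θ)) x +
    ∑ n ∈ Finset.Icc 1 (nbar p i), ∑ z : Bool,
      (tri p i k n z).indicator (fun _ => triGrad p i k n z - rot (sgn i * p.θ)) x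

/-- The open `k`-th square of strip `i`. -/
def openSquare (p : Params) (i : Fin 2) (k : ℕ) : Set Plane :=
  {x | |locX p i x| < spacing p i ∧ |locY p i k x| < spacing p i}

lemma openSquare_unique {p : Params} {i j : Fin 2} {k m : ℕ} {x : Plane}
    (h : x ∈ openSquare p i k) (h' : x ∈ openSquare p j m) : i = j ∧ k = m := by
  have h1 := (abs_lt.1 h.1).2
  have h2 := (abs_lt.1 h'.1).2
  have hij : i = j := by
    apply sgn_injective
    simp only [locX] at h1 h2
    rcases sgn_eq i with hi | hi <;> rcases sgn_eq j with hj | hj <;> rw [hi, hj] <;>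
      rw [hi] at h1 <;> rw [hj] at h2 <;> linarith
  subst hij
  refine ⟨rfl, ?_⟩
  have h3 := abs_lt.1 h.2
  have h4 := abs_lt.1 h'.2
  have hl : 0 < spacing p i := (abs_nonneg _).trans_lt h.1
  simp only [locY] at h3 h4
  have e1 : (k : ℝ) < m + 1 := by
    by_contra hc
    push Not at hc
    nlinarith [mul_le_mul_of_nonneg_right hc hl.le]
  have e2 : (m : ℝ) < k + 1 := by
    by_contra hc
    push Not at hc
    nlinarith [mul_le_mul_of_nonneg_right hc hl.le]
  have e1' : k < m + 1 := by exact_mod_cast e1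
  have e2' : m < k + 1 := by exact_mod_cast e2
  omega

/-- The strip of a square lies on one side of the interface. -/
lemma baseField_eq {p : Params} {i : Fin 2} {k : ℕ} {x : Plane} (h : x ∈ openSquare p i k) :
    baseField p x = rot (sgn i * p.θ) := by
  have h1 := (abs_lt.1 h.1).2
  simp only [locX] at h1
  unfold baseField
  fin_cases i
  · have hx : x 0 < 0 := by
      norm_num [sgn] at h1
      linarith
    rw [if_pos hx]
    simp [sgn]
  · have hx : ¬ x 0 < 0 := by
      norm_num [sgn] at h1
      linarith
    rw [if_neg hx]
    simp [sgn]

lemma squareField_of_notMem {p : Params} {i : Fin 2} {k : ℕ} {x : Plane} (hc : x ∉ coreSq p i k)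
    (ht : ∀ n z, 1 ≤ n → n ≤ nbar p i → x ∉ tri p i k n z) : squareField p i k x = 0 := by
  rw [squareField, indicator_of_notMem hc, zero_add]
  refine Finset.sum_eq_zero fun n hn => Finset.sum_eq_zero fun z _ => ?_
  rw [Finset.mem_Icc] at hn
  exact indicator_of_notMem (ht n z hn.1 hn.2) _

section

variable {p : Params} (hS : Standing p) (hC : SignCond p)

include hS hC in
/-- The triangles of the `n`-th annulus lie in the trapezoid `r_{n-1} ≤ X ≤ r_n`, `|Y| ≤ X`. -/
lemma bounds_of_mem_tri {i : Fin 2} {k n : ℕ} {z : Bool} {x : Plane} (hn : 1 ≤ n)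
    (hx : x ∈ tri p i k n z) : radius p i (n - 1) ≤ locX p i x ∧
      locX p i x ≤ radius p i n ∧ |locY p i k x| ≤ locX p i x := by
  have hr := radius_pos hS hC i (n - 1)
  rw [radius_eq_two_mul p i hn, abs_le]
  cases z
  · obtain ⟨h1, h2, h3⟩ := (mem_tri_false k hn hr).1 hx
    refine ⟨h1, by linarith, by linarith, h2⟩
  · obtain ⟨h1, h2, h3⟩ := (mem_tri_true k hn hr).1 hx
    refine ⟨by linarith, h1, by linarith, by linarith⟩

include hS hC in
lemma mem_openSquare_of_mem_coreSq {i : Fin 2} {k : ℕ} {x : Plane} (hg : IsGeneric p x)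
    (hx : x ∈ coreSq p i k) : x ∈ openSquare p i k := by
  obtain ⟨h1, h2⟩ := mem_coreSq.1 hx
  obtain ⟨g1, g2, g3, g4, -⟩ := hg.2 i k 0
  have hr := radius_le_spacing hS hC i (Nat.zero_le _)
  rw [abs_le] at h1 h2
  refine ⟨abs_lt.2 ⟨?_, ?_⟩, abs_lt.2 ⟨?_, ?_⟩⟩
  · linarith [lt_of_le_of_ne h1.1 g2.symm]
  · linarith [lt_of_le_of_ne h1.2 g1]
  · linarith [lt_of_le_of_ne h2.1 g4.symm]
  · linarith [lt_of_le_of_ne h2.2 g3]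

include hS hC in
lemma mem_openSquare_of_mem_tri {i : Fin 2} {k n : ℕ} {z : Bool} {x : Plane} (hg : IsGeneric p x)
    (hn : 1 ≤ n) (hn' : n ≤ nbar p i) (hx : x ∈ tri p i k n z) : x ∈ openSquare p i k := by
  obtain ⟨h1, h2, h3⟩ := bounds_of_mem_tri hS hC hn hx
  have hr := radius_le_spacing hS hC i hn'
  have hlt := lt_of_le_of_ne h2 (hg.2 i k n).1
  have hp := radius_pos hS hC i (n - 1)
  exact ⟨by rw [abs_of_pos (by linarith)]; linarith, by linarith⟩

include hS hC in
lemma notMem_coreSq_of_mem_tri {i : Fin 2} {k n : ℕ} {z : Bool} {x : Plane} (hg : IsGeneric p x)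
    (hn : 1 ≤ n) (hx : x ∈ tri p i k n z) : x ∉ coreSq p i k := by
  intro hc
  have h1 := (bounds_of_mem_tri hS hC hn hx).1
  have h2 := (abs_le.1 (mem_coreSq.1 hc).1).2
  have h3 := lt_of_le_of_ne h1 (hg.2 i k (n - 1)).1.symm
  have h4 := radius_mono hS hC i (Nat.zero_le (n - 1))
  linarith

include hS hC in
lemma tri_unique {i : Fin 2} {k n m : ℕ} {z w : Bool} {x : Plane} (hg : IsGeneric p x)
    (hn : 1 ≤ n) (hm : 1 ≤ m) (hx : x ∈ tri p i k n z) (hx' : x ∈ tri p i k m w) :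
    n = m ∧ z = w := by
  have hle : ∀ {n m : ℕ} {z w : Bool}, 1 ≤ n → 1 ≤ m → x ∈ tri p i k n z → x ∈ tri p i k m w →
      n ≤ m := by
    intro n m z w hn hm hx hx'
    by_contra hc
    have h1 := (bounds_of_mem_tri hS hC hn hx).1
    have h2 := (bounds_of_mem_tri hS hC hm hx').2.1
    have h3 := lt_of_le_of_ne h1 (hg.2 i k (n - 1)).1.symm
    have h4 := radius_mono hS hC i (show m ≤ n - 1 by omega)
    linarith
  have hnm : n = m := le_antisymm (hle hn hm hx hx') (hle hm hn hx' hx)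
  subst hnm
  refine ⟨rfl, ?_⟩
  have hr := radius_pos hS hC i (n - 1)
  have hs := (hg.2 i k (n - 1)).2.2.2.2.2.2
  cases z <;> cases w <;> try rfl
  · exact absurd (le_antisymm ((mem_tri_true k hn hr).1 hx').2.2 ((mem_tri_false k hn hr).1 hx).2.2)
      hs
  · exact absurd (le_antisymm ((mem_tri_true k hn hr).1 hx).2.2 ((mem_tri_false k hn hr).1 hx').2.2)
      hs

include hS hC in
lemma squareField_of_mem_coreSq {i : Fin 2} {k : ℕ} {x : Plane} (hg : IsGeneric p x)
    (hc : x ∈ coreSq p i k) : squareField p i k x = 1 - rot (sgn i * p.θ) := by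
  rw [squareField, indicator_of_mem hc, add_eq_left]
  refine Finset.sum_eq_zero fun n hn => Finset.sum_eq_zero fun z _ => ?_
  rw [Finset.mem_Icc] at hn
  exact indicator_of_notMem (fun h => notMem_coreSq_of_mem_tri hS hC hg hn.1 h hc) _

include hS hC in
lemma squareField_of_mem_tri {i : Fin 2} {k n : ℕ} {z : Bool} {x : Plane} (hg : IsGeneric p x)
    (hn : 1 ≤ n) (hn' : n ≤ nbar p i) (hx : x ∈ tri p i k n z) :
    squareField p i k x = triGrad p i k n z - rot (sgn i * p.θ) := by
  rw [squareField, indicator_of_notMem (notMem_coreSq_of_mem_tri hS hC hg hn hx), zero_add,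
    Finset.sum_eq_single n, Finset.sum_eq_single z, indicator_of_mem hx]
  · intro w _ hw
    exact indicator_of_notMem (fun h => hw (tri_unique hS hC hg hn hn hx h).2.symm) _
  · simp
  · intro m hm hmn
    refine Finset.sum_eq_zero fun w _ => ?_
    rw [Finset.mem_Icc] at hm
    exact indicator_of_notMem (fun h => hmn (tri_unique hS hC hg hn hm.1 hx h).1.symm) _
  · intro h
    exact absurd (Finset.mem_Icc.2 ⟨hn, hn'⟩) h

include hS hC in
lemma squareField_of_notMem_openSquare {i : Fin 2} {k : ℕ} {x : Plane} (hg : IsGeneric p x)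
    (hx : x ∉ openSquare p i k) : squareField p i k x = 0 :=
  squareField_of_notMem (fun h => hx (mem_openSquare_of_mem_coreSq hS hC hg h))
    fun _ _ hn hn' h => hx (mem_openSquare_of_mem_tri hS hC hg hn hn' h)

include hS hC in
lemma sum_squareField {i : Fin 2} {k : ℕ} {x : Plane} (hg : IsGeneric p x) (hk : 1 ≤ k)
    (hk' : k ≤ numSq p i) (hx : x ∈ openSquare p i k) :
    ∑ j, ∑ m ∈ Finset.Icc 1 (numSq p j), squareField p j m x = squareField p i k x := by
  rw [Finset.sum_eq_single i, Finset.sum_eq_single k]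
  · intro m _ hm
    exact squareField_of_notMem_openSquare hS hC hg
      fun h => hm (openSquare_unique hx h).2.symm
  · intro h
    exact absurd (Finset.mem_Icc.2 ⟨hk, hk'⟩) h
  · intro j _ hj
    exact Finset.sum_eq_zero fun m _ => squareField_of_notMem_openSquare hS hC hg
      fun h => hj (openSquare_unique hx h).1.symm
  · simp

include hS hC in
/-- Away from the edges of the pieces, the choice in the definition of the strain is
irrelevant. -/
lemma strain_eq_of_isGeneric {x : Plane} (hg : IsGeneric p x) :
    strain p x = baseField p x + ∑ i, ∑ k ∈ Finset.Icc 1 (numSq p i), squareField p i k x := by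
  unfold strain
  split_ifs with h1 h2 h3
  · obtain ⟨i, k, hk, hk', hx⟩ := h1
    have ho := mem_openSquare_of_mem_coreSq hS hC hg hx
    rw [sum_squareField hS hC hg hk hk' ho, baseField_eq ho,
      squareField_of_mem_coreSq hS hC hg hx, add_sub_cancel]
  · obtain ⟨hk, hk', hn, hn', hx⟩ := h2.choose_spec
    have ho := mem_openSquare_of_mem_tri hS hC hg hn hn' hx
    rw [sum_squareField hS hC hg hk hk' ho, baseField_eq ho,
      squareField_of_mem_tri hS hC hg hn hn' hx, add_sub_cancel]
  all_goals
    have hz : ∑ i, ∑ k ∈ Finset.Icc 1 (numSq p i), squareField p i k x = 0 := by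
      refine Finset.sum_eq_zero fun i _ => Finset.sum_eq_zero fun k hk => ?_
      rw [Finset.mem_Icc] at hk
      exact squareField_of_notMem (fun h => h1 ⟨i, k, hk.1, hk.2, h⟩)
        fun n z hn hn' h => h2 ⟨(i, k, n, z), hk.1, hk.2, hn, hn', h⟩
    rw [hz, add_zero, baseField]
    simp only [h3, if_true, if_false]

end

/-! ### The distributional curl of the strain -/

lemma setIntegral_of_ae_eq_diff {f : Plane → ℝ} (hf : Integrable f) {A B P : Set Plane}
    (hB : MeasurableSet B) (hBA : B ⊆ A) (hP : P =ᵐ[volume] (A \ B : Set Plane)) :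
    ∫ x in P, f x = (∫ x in A, f x) - ∫ x in B, f x := by
  rw [setIntegral_congr_set hP, setIntegral_sdiff hB hf.integrableOn hBA]

/-- The points of an annulus around the `k`-th square, with local coordinates `r < X < 2 r` and
`Y < m X + q`. -/
def wedge (p : Params) (i : Fin 2) (k : ℕ) (r m q : ℝ) : Set Plane :=
  {x | r < locX p i x ∧ locX p i x < 2 * r ∧ locY p i k x < m * locX p i x + q}

lemma wedge_eq_of_neg {p : Params} {i : Fin 2} (h : sgn i = -1) (k : ℕ) (r m q : ℝ) :
    wedge p i k r m q = halfStrip (r - spacing p i) (2 * r - spacing p i) m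
      (m * spacing p i + q - (2 * (k : ℝ) - 1) * spacing p i) := by
  ext x
  simp only [wedge, halfStrip, mem_ofPred_eq, locX, locY, h]
  constructor <;> rintro ⟨h1, h2, h3⟩ <;> refine ⟨?_, ?_, ?_⟩ <;> linarith

lemma wedge_eq_of_pos {p : Params} {i : Fin 2} (h : sgn i = 1) (k : ℕ) (r m q : ℝ) :
    wedge p i k r m q = halfStrip (spacing p i - 2 * r) (spacing p i - r) (-m)
      (m * spacing p i + q - (2 * (k : ℝ) - 1) * spacing p i) := by
  ext x
  simp only [wedge, halfStrip, mem_ofPred_eq, locX, locY, h]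
  constructor <;> rintro ⟨h1, h2, h3⟩ <;> refine ⟨?_, ?_, ?_⟩ <;> linarith

lemma measurableSet_wedge (p : Params) (i : Fin 2) (k : ℕ) (r m q : ℝ) :
    MeasurableSet (wedge p i k r m q) := by
  rcases sgn_eq i with h | h
  · rw [wedge_eq_of_neg h]
    exact measurableSet_halfStrip _ _ _ _
  · rw [wedge_eq_of_pos h]
    exact measurableSet_halfStrip _ _ _ _

lemma setIntegral_wedge {χ : Plane → ℝ} (hχ : ContDiff ℝ ∞ χ) (hc : HasCompactSupport χ)
    (p : Params) (i : Fin 2) (k : ℕ) {r : ℝ} (hr : 0 < r) (m q : ℝ) :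
    -sgn i * (∫ x in wedge p i k r m q, partialD 0 χ x) +
        m * ∫ x in wedge p i k r m q, partialD 1 χ x =
      lineIntegral χ (sgn i * (spacing p i - 2 * r))
          (m * (2 * r) + q - (2 * (k : ℝ) - 1) * spacing p i) -
        lineIntegral χ (sgn i * (spacing p i - r))
          (m * r + q - (2 * (k : ℝ) - 1) * spacing p i) := by
  have h0 (P : Set Plane) := (integrable_partialD hχ hc 0).integrableOn (s := P)
  have h1 (P : Set Plane) := (integrable_partialD hχ hc 1).integrableOn (s := P)
  rcases sgn_eq i with h | h
  · rw [wedge_eq_of_neg h, h]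
    have := setIntegral_halfStrip_tangential hχ hc
      (show r - spacing p i ≤ 2 * r - spacing p i by linarith) m
      (m * spacing p i + q - (2 * (k : ℝ) - 1) * spacing p i)
    rw [integral_add (h0 _) ((h1 _).const_mul m), integral_const_mul] at this
    rw [neg_neg, one_mul, this]
    congr 2 <;> ring
  · rw [wedge_eq_of_pos h, h]
    have := setIntegral_halfStrip_tangential hχ hc
      (show spacing p i - 2 * r ≤ spacing p i - r by linarith) (-m)
      (m * spacing p i + q - (2 * (k : ℝ) - 1) * spacing p i)
    rw [integral_add (h0 _) ((h1 _).const_mul (-m)), integral_const_mul] at this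
    have e : ∀ A B : ℝ, -1 * A + m * B = -(A + -m * B) := fun A B => by ring
    rw [e, this, neg_sub]
    congr 2 <;> ring

lemma ae_eq_of_isGeneric (p : Params) {P Q : Set Plane}
    (h : ∀ x, IsGeneric p x → (x ∈ P ↔ x ∈ Q)) : P =ᵐ[volume] Q := by
  filter_upwards [ae_isGeneric p] with x hx
  exact propext (h x hx)

lemma tri_false_ae_eq {p : Params} {i : Fin 2} (k : ℕ) {n : ℕ} (hn : 1 ≤ n)
    (hr : 0 < radius p i (n - 1)) :
    tri p i k n false =ᵐ[volume] (wedge p i k (radius p i (n - 1)) 1 0 \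
      wedge p i k (radius p i (n - 1)) 3 (-(4 * radius p i (n - 1))) : Set Plane) := by
  refine ae_eq_of_isGeneric p fun x hx => ?_
  obtain ⟨g1, -, -, -, g5, -, g7⟩ := hx.2 i k (n - 1)
  rw [mem_tri_false k hn hr]
  simp only [wedge, mem_sdiff, mem_ofPred_eq, not_and, not_lt]
  constructor
  · rintro ⟨h1, h2, h3⟩
    have h2' := lt_of_le_of_ne h2 g5
    exact ⟨⟨lt_of_le_of_ne h1 g1.symm, by linarith, by linarith⟩, fun _ _ => by linarith⟩
  · rintro ⟨⟨h1, h2, h3⟩, h4⟩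
    have := h4 h1 h2
    exact ⟨h1.le, by linarith, by linarith⟩

lemma tri_true_ae_eq {p : Params} {i : Fin 2} (k : ℕ) {n : ℕ} (hn : 1 ≤ n)
    (hr : 0 < radius p i (n - 1)) :
    tri p i k n true =ᵐ[volume]
      (wedge p i k (radius p i (n - 1)) 3 (-(4 * radius p i (n - 1))) \
        wedge p i k (radius p i (n - 1)) (-1) 0 : Set Plane) := by
  refine ae_eq_of_isGeneric p fun x hx => ?_
  obtain ⟨g1, -, -, -, -, g6, g7⟩ := hx.2 i k (n - 1)
  have g8 := (hx.2 i k n).1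
  rw [radius_eq_two_mul p i hn] at g8
  rw [mem_tri_true k hn hr]
  simp only [wedge, mem_sdiff, mem_ofPred_eq, not_and, not_lt]
  constructor
  · rintro ⟨h1, h2, h3⟩
    have h3' := lt_of_le_of_ne h3 g7
    exact ⟨⟨by linarith [lt_of_le_of_ne h2 g6.symm], lt_of_le_of_ne h1 g8, by linarith⟩,
      fun _ _ => by linarith⟩
  · rintro ⟨⟨h1, h2, h3⟩, h4⟩
    have := h4 h1 h2
    exact ⟨h2.le, by linarith, by linarith⟩

/-- The pairing of the rotated gradient of `χ` with the constant covector `u` on `P`. -/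
def flux (χ : Plane → ℝ) (P : Set Plane) (u : Fin 2 → ℝ) : ℝ :=
  u 1 * (∫ x in P, partialD 0 χ x) - u 0 * ∫ x in P, partialD 1 χ x

/-- The mean of `χ` over the vertical edge, on the side of the interface, of the square of half
side `r` about the `k`-th centre. -/
def edgeMean (χ : Plane → ℝ) (p : Params) (i : Fin 2) (k : ℕ) (r : ℝ) : ℝ :=
  (lineIntegral χ (sgn i * (spacing p i - r)) (r - (2 * (k : ℝ) - 1) * spacing p i) -
    lineIntegral χ (sgn i * (spacing p i - r)) (-r - (2 * (k : ℝ) - 1) * spacing p i)) / (2 * r)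

/-- The two triangles of an annulus transport the edge mean from one radius to the next: the
slanted edges do not contribute, since the profile is constant on the outer ones and continuous
across the inner one. -/
lemma sum_flux_tri {χ : Plane → ℝ} (hχ : ContDiff ℝ ∞ χ) (hc : HasCompactSupport χ)
    {p : Params} {i : Fin 2} (k : ℕ) {n : ℕ} (hn : 1 ≤ n) (hr : 0 < radius p i (n - 1)) (K : ℝ) :
    ∑ z : Bool, flux χ (tri p i k n z)
        (fun b => -sgn i * K * triCov i (radius p i (n - 1)) z b) =
      K * (edgeMean χ p i k (radius p i (n - 1)) - edgeMean χ p i k (radius p i n)) := by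
  rw [Fintype.sum_bool]
  set r := radius p i (n - 1) with hrd
  have hi (j : Fin 2) := integrable_partialD hχ hc j
  have hsub1 : wedge p i k r 3 (-(4 * r)) ⊆ wedge p i k r 1 0 := by
    rintro x ⟨h1, h2, h3⟩
    exact ⟨h1, h2, by linarith⟩
  have hsub2 : wedge p i k r (-1) 0 ⊆ wedge p i k r 3 (-(4 * r)) := by
    rintro x ⟨h1, h2, h3⟩
    exact ⟨h1, h2, by linarith⟩
  have hf (j : Fin 2) := setIntegral_of_ae_eq_diff (hi j) (measurableSet_wedge p i k r _ _) hsub1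
    (tri_false_ae_eq k hn hr)
  have ht (j : Fin 2) := setIntegral_of_ae_eq_diff (hi j) (measurableSet_wedge p i k r _ _) hsub2
    (tri_true_ae_eq k hn hr)
  have w1 := setIntegral_wedge hχ hc p i k hr 1 0
  have w3 := setIntegral_wedge hχ hc p i k hr 3 (-(4 * r))
  have wm := setIntegral_wedge hχ hc p i k hr (-1) 0
  have hs := sgn_mul_self i
  simp only [flux, hf, ht, triCov, edgeMean, radius_eq_two_mul p i hn, ← hrd,
    Matrix.cons_val_zero, Matrix.cons_val_one]
  rw [show (3 * (2 * r) + -(4 * r) - (2 * (k : ℝ) - 1) * spacing p i) =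
    2 * r - (2 * (k : ℝ) - 1) * spacing p i by ring,
    show (3 * r + -(4 * r) - (2 * (k : ℝ) - 1) * spacing p i) =
    -r - (2 * (k : ℝ) - 1) * spacing p i by ring] at w3
  simp only [one_mul, add_zero, neg_one_mul] at w1 wm
  linear_combination (-K / (2 * r)) * w1 + (K / (4 * r)) * w3 + (K / (4 * r)) * wm +
    (K / (4 * r) * ((∫ x in wedge p i k r 3 (-(4 * r)), partialD 1 χ x) -
      ∫ x in wedge p i k r (-1) 0, partialD 1 χ x) -
    K / (2 * r) * ((∫ x in wedge p i k r 1 0, partialD 1 χ x) -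
      ∫ x in wedge p i k r 3 (-(4 * r)), partialD 1 χ x)) * hs

/-- The constant strain in a core has no curl against functions which are constant on the boundary
of the core. -/
lemma flux_coreSq {χ : Plane → ℝ} (hχ : ContDiff ℝ ∞ χ) (hc : HasCompactSupport χ)
    {p : Params} {i : Fin 2} {k : ℕ} (hr : 0 < radius p i 0) {c : ℝ}
    (h : ∀ x ∈ coreBdry p i k, χ x = c) (u : Fin 2 → ℝ) : flux χ (coreSq p i k) u = 0 := by
  set r := radius p i 0 with hrd
  set X := center p i k 0 with hX
  set Y := center p i k 1 with hY
  have hab : X - r ≤ X + r := by linarith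
  have hP : coreSq p i k =ᵐ[volume]
      (halfStrip (X - r) (X + r) 0 (Y + r) \ halfStrip (X - r) (X + r) 0 (Y - r) : Set Plane) := by
    filter_upwards [ae_fst_ne (X - r), ae_fst_ne (X + r), ae_snd_ne 0 (Y + r)] with x h1 h2 h3
    refine propext ?_
    change max |x 0 - X| |x 1 - Y| ≤ r ↔ x ∈
      (halfStrip (X - r) (X + r) 0 (Y + r) \ halfStrip (X - r) (X + r) 0 (Y - r) : Set Plane)
    rw [max_le_iff, abs_le, abs_le]
    simp only [halfStrip, mem_sdiff, mem_ofPred_eq, not_and, not_lt, zero_mul, zero_add] at h3 ⊢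
    constructor
    · rintro ⟨⟨h4, h5⟩, h6, h7⟩
      exact ⟨⟨lt_of_le_of_ne (by linarith) h1.symm, lt_of_le_of_ne (by linarith) h2,
        lt_of_le_of_ne (by linarith) h3⟩, fun _ _ => by linarith⟩
    · rintro ⟨⟨h4, h5, h6⟩, h7⟩
      have := h7 h4 h5
      exact ⟨⟨by linarith, by linarith⟩, by linarith, by linarith⟩
  have hsub : halfStrip (X - r) (X + r) 0 (Y - r) ⊆ halfStrip (X - r) (X + r) 0 (Y + r) := by
    rintro x ⟨h1, h2, h3⟩
    exact ⟨h1, h2, by linarith⟩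
  have hv (t : ℝ) (ht : |t| = r) (y : ℝ) (hy : |y| ≤ r) : χ !₂[X + t, Y + y] = c := by
    apply h
    change max |(X + t) - X| |(Y + y) - Y| = r
    rw [add_sub_cancel_left, add_sub_cancel_left, ht, max_eq_left hy]
  have hh (t : ℝ) (ht : |t| = r) (x : ℝ) (hx : |x| ≤ r) : χ !₂[X + x, Y + t] = c := by
    apply h
    change max |(X + x) - X| |(Y + t) - Y| = r
    rw [add_sub_cancel_left, add_sub_cancel_left, ht, max_eq_right hx]
  have har : |r| = r := abs_of_pos hr
  have har' : |(-r)| = r := by rw [abs_neg, har]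
  have h0 : ∫ x in coreSq p i k, partialD 0 χ x = 0 := by
    have ht (q : ℝ) := setIntegral_halfStrip_tangential hχ hc hab 0 q
    simp only [zero_mul, add_zero, zero_add] at ht
    have hl (t : ℝ) (ht : |t| = r) :
        lineIntegral χ (X + t) (Y + r) - lineIntegral χ (X + t) (Y - r) = 2 * r * c := by
      rw [lineIntegral_sub hχ.continuous hc (X + t) (show Y - r ≤ Y + r by linarith) (c := c)]
      · ring
      · intro y hy
        have := hv t ht (y - Y) (abs_le.2 ⟨by linarith [hy.1], by linarith [hy.2]⟩)
        rwa [add_sub_cancel] at this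
    rw [setIntegral_of_ae_eq_diff (integrable_partialD hχ hc 0)
      (measurableSet_halfStrip _ _ _ _) hsub hP, ht, ht]
    have e1 := hl r har
    have e2 := hl (-r) har'
    rw [← sub_eq_add_neg] at e2
    linarith
  have h1 : ∫ x in coreSq p i k, partialD 1 χ x = 0 := by
    have hl (t : ℝ) (ht : |t| = r) :
        ∀ x ∈ Ioo (X - r) (X + r), χ !₂[x, Y + t] = c := by
      intro x hx
      have := hh t ht (x - X) (abs_le.2 ⟨by linarith [hx.1], by linarith [hx.2]⟩)
      rwa [add_sub_cancel] at this
    have hl' := hl (-r) har'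
    rw [← sub_eq_add_neg] at hl'
    rw [setIntegral_of_ae_eq_diff (integrable_partialD hχ hc 1)
      (measurableSet_halfStrip _ _ _ _) hsub hP,
      setIntegral_halfStrip_vertical hχ hc hab (hl r har),
      setIntegral_halfStrip_vertical hχ hc hab hl', sub_self]
  rw [flux, h0, h1]
  ring

lemma interior_Omega_subset (p : Params) :
    interior (Omega p) ⊆ {x | -p.L < x 0 ∧ x 0 < p.L ∧ -2 * p.L < x 1 ∧ x 1 < 0} := by
  have hopen (i : Fin 2) : IsOpenMap fun x : Plane => x i := by
    have hsurj : Function.Surjective (EuclideanSpace.proj i : Plane →L[ℝ] ℝ) := fun t =>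
      ⟨EuclideanSpace.single i t, by simp⟩
    exact (EuclideanSpace.proj i : Plane →L[ℝ] ℝ).isOpenMap hsurj
  have key (i : Fin 2) (a b : ℝ) (h : ∀ x ∈ Omega p, x i ∈ Icc a b) :
      ∀ x ∈ interior (Omega p), x i ∈ Ioo a b := by
    intro x hx
    have h1 : (fun x : Plane => x i) '' interior (Omega p) ⊆ interior (Icc a b) := by
      refine interior_maximal ?_ (hopen i _ isOpen_interior)
      rintro _ ⟨y, hy, rfl⟩
      exact h y (interior_subset hy)
    rw [interior_Icc] at h1
    exact h1 ⟨x, hx, rfl⟩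
  intro x hx
  have h0 := key 0 _ _ (fun y hy => hy.1) x hx
  have h1 := key 1 _ _ (fun y hy => hy.2) x hx
  exact ⟨h0.1, h0.2, h1.1, h1.2⟩

lemma isClosed_coreSq (p : Params) (i : Fin 2) (k : ℕ) : IsClosed (coreSq p i k) :=
  isClosed_le (by fun_prop) continuous_const

lemma isClosed_coreBdry (p : Params) (i : Fin 2) (k : ℕ) : IsClosed (coreBdry p i k) :=
  isClosed_eq (by fun_prop) continuous_const

lemma isClosed_tri (p : Params) (i : Fin 2) (k n : ℕ) (z : Bool) : IsClosed (tri p i k n z) :=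
  ((finite_range _).isCompact_convexHull (𝕜 := ℝ)).isClosed

/-- The integrand of the distributional curl of row `a` of a constant strain. -/
def curlDensity (χ : Plane → ℝ) (a : Fin 2) (M : Mat) (x : Plane) : ℝ :=
  partialD 0 χ x * M a 1 - partialD 1 χ x * M a 0

lemma curlDensity_add (χ : Plane → ℝ) (a : Fin 2) (M N : Mat) (x : Plane) :
    curlDensity χ a (M + N) x = curlDensity χ a M x + curlDensity χ a N x := by
  simp only [curlDensity, Matrix.add_apply]
  ring

lemma curlDensity_sum {ι : Type*} (s : Finset ι) (χ : Plane → ℝ) (a : Fin 2) (M : ι → Mat)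
    (x : Plane) : curlDensity χ a (∑ j ∈ s, M j) x = ∑ j ∈ s, curlDensity χ a (M j) x := by
  simp only [curlDensity, Matrix.sum_apply, Finset.mul_sum, Finset.sum_sub_distrib]

lemma curlDensity_indicator (χ : Plane → ℝ) (a : Fin 2) (P : Set Plane) (M : Mat) (x : Plane) :
    curlDensity χ a (P.indicator (fun _ => M) x) x = P.indicator (curlDensity χ a M) x := by
  by_cases h : x ∈ P <;> simp [h, curlDensity]

lemma integrable_curlDensity {χ : Plane → ℝ} (hχ : ContDiff ℝ ∞ χ) (hc : HasCompactSupport χ)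
    (a : Fin 2) (M : Mat) : Integrable (curlDensity χ a M) :=
  ((integrable_partialD hχ hc 0).mul_const _).sub ((integrable_partialD hχ hc 1).mul_const _)

lemma setIntegral_curlDensity {χ : Plane → ℝ} (hχ : ContDiff ℝ ∞ χ) (hc : HasCompactSupport χ)
    (a : Fin 2) (M : Mat) (P : Set Plane) :
    ∫ x in P, curlDensity χ a M x = flux χ P (M a) := by
  simp only [curlDensity, flux]
  rw [integral_sub ((integrable_partialD hχ hc 0).integrableOn.mul_const _)
    ((integrable_partialD hχ hc 1).integrableOn.mul_const _), integral_mul_const,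
    integral_mul_const]
  ring

lemma flux_base {χ : Plane → ℝ} (hχ : ContDiff ℝ ∞ χ) (hc : HasCompactSupport χ)
    {p : Params} (hL : 0 < p.L) (hs : tsupport χ ⊆ interior (Omega p)) (a : Fin 2) :
    flux χ (halfStrip (-p.L) 0 0 0) (rot (-p.θ) a) + flux χ (halfStrip 0 p.L 0 0) (rot p.θ a) =
      (rot (-p.θ) a 1 - rot p.θ a 1) * lineIntegral χ 0 0 := by
  have hz (x : Plane) (hx : ¬(-p.L < x 0 ∧ x 0 < p.L ∧ -2 * p.L < x 1 ∧ x 1 < 0)) : χ x = 0 :=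
    image_eq_zero_of_notMem_tsupport fun h => hx (interior_Omega_subset p (hs h))
  have v1 := setIntegral_halfStrip_vertical hχ hc (show -p.L ≤ 0 by linarith) (q := 0) (c := 0)
    fun x _ => hz _ fun h => lt_irrefl _ h.2.2.2
  have v2 := setIntegral_halfStrip_vertical hχ hc hL.le (q := 0) (c := 0)
    fun x _ => hz _ fun h => lt_irrefl _ h.2.2.2
  have t1 := setIntegral_halfStrip_tangential hχ hc (show -p.L ≤ 0 by linarith) 0 0
  have t2 := setIntegral_halfStrip_tangential hχ hc hL.le 0 0
  simp only [zero_mul, add_zero] at t1 t2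
  rw [lineIntegral_eq_zero (x := -p.L) fun y _ => hz _ fun h => lt_irrefl _ h.1] at t1
  rw [lineIntegral_eq_zero (x := p.L) fun y _ => hz _ fun h => lt_irrefl _ h.2.1] at t2
  simp only [flux, v1, v2, t1, t2]
  ring

section

variable {p : Params} (hS : Standing p) (hC : SignCond p)

include hS hC in
/-- The contributions of the squares of strip `i` telescope, over the annuli and then over the
squares, to the values of `χ` on the cores and its integral over the interface. -/
lemma sum_flux_square {χ : Plane → ℝ} (hχ : ContDiff ℝ ∞ χ) (hc : HasCompactSupport χ)
    (hs : tsupport χ ⊆ interior (Omega p)) (i : Fin 2) {c : ℕ → ℝ}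
    (h : ∀ k, 1 ≤ k → k ≤ numSq p i → ∀ x ∈ coreBdry p i k, χ x = c k) (a : Fin 2) :
    ∑ k ∈ Finset.Icc 1 (numSq p i), (flux χ (coreSq p i k) ((1 - rot (sgn i * p.θ)) a) +
      ∑ n ∈ Finset.Icc 1 (nbar p i), ∑ z : Bool,
        flux χ (tri p i k n z) ((triGrad p i k n z - rot (sgn i * p.θ)) a)) =
    ∑ k ∈ Finset.Icc 1 (numSq p i), p.τ * p.ε * gen p i a * c k -
      p.τ * p.ε * gen p i a / (2 * spacing p i) * lineIntegral χ 0 0 := by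
  have hl := spacing_pos hS hC i
  have hr0 := radius_pos hS hC i 0
  set K := p.τ * p.ε * gen p i a with hK
  have htel (k : ℕ) (N : ℕ) :
      ∑ n ∈ Finset.Icc 1 N, ∑ z : Bool,
        flux χ (tri p i k n z) ((triGrad p i k n z - rot (sgn i * p.θ)) a) =
      K * (edgeMean χ p i k (radius p i 0) - edgeMean χ p i k (radius p i N)) := by
    induction N with
    | zero => simp
    | succ N ih =>
      rw [Finset.sum_Icc_succ_top (by omega), ih]
      have hrow (z : Bool) : (triGrad p i k (N + 1) z - rot (sgn i * p.θ)) a =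
          fun b => -sgn i * K * triCov i (radius p i (N + 1 - 1)) z b := by
        funext b
        rw [Matrix.sub_apply, triGrad_apply k (by omega) (radius_pos hS hC i _), hK]
        ring
      simp only [hrow]
      rw [sum_flux_tri hχ hc k (by omega) (radius_pos hS hC i _)]
      simp only [Nat.add_sub_cancel]
      ring
  have hedge (k : ℕ) (hk : 1 ≤ k) (hk' : k ≤ numSq p i) :
      edgeMean χ p i k (radius p i 0) = c k := by
    set r := radius p i 0 with hr
    rw [edgeMean, lineIntegral_sub hχ.continuous hc _ (c := c k) (by linarith)]
    · field_simp
      ring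
    · intro y hy
      refine h k hk hk' _ ?_
      change max |sgn i * (spacing p i - r) - sgn i * spacing p i|
        |y - -(2 * (k : ℝ) - 1) * spacing p i| = r
      have e1 : |sgn i * (spacing p i - r) - sgn i * spacing p i| = r := by
        rcases sgn_eq i with h | h <;> rw [h] <;> ring_nf <;> simp [abs_of_pos hr0]
      rw [e1, max_eq_left (abs_le.2 ⟨by linarith [hy.1], by linarith [hy.2]⟩)]
  have hsum (N : ℕ) : ∑ k ∈ Finset.Icc 1 N, edgeMean χ p i k (spacing p i) =
      (lineIntegral χ 0 0 - lineIntegral χ 0 (-(2 * N * spacing p i))) / (2 * spacing p i) := by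
    induction N with
    | zero => simp
    | succ N ih =>
      rw [Finset.sum_Icc_succ_top (by omega), ih, edgeMean, ← add_div]
      push_cast
      rw [sub_self, mul_zero, show spacing p i - (2 * ((N : ℝ) + 1) - 1) * spacing p i =
        -(2 * N * spacing p i) by ring, show -spacing p i - (2 * ((N : ℝ) + 1) - 1) * spacing p i =
        -(2 * ((N : ℝ) + 1) * spacing p i) by ring]
      ring
  -- the squares reach the bottom of the domain, below which `χ` vanishes
  have hbot : lineIntegral χ 0 (-(2 * numSq p i * spacing p i)) = 0 := by
    refine lineIntegral_eq_zero fun y hy => image_eq_zero_of_notMem_tsupport fun hm => ?_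
    have h1 := (interior_Omega_subset p (hs hm)).2.2.1
    have h2 : p.L ≤ numSq p i * spacing p i := by
      rw [← div_le_iff₀ hl]
      exact Nat.le_ceil _
    have h3 : -2 * p.L < y := h1
    linarith
  have hsq (k : ℕ) (hk : k ∈ Finset.Icc 1 (numSq p i)) :
      flux χ (coreSq p i k) ((1 - rot (sgn i * p.θ)) a) +
        ∑ n ∈ Finset.Icc 1 (nbar p i), ∑ z : Bool,
          flux χ (tri p i k n z) ((triGrad p i k n z - rot (sgn i * p.θ)) a) =
      K * c k - K * edgeMean χ p i k (spacing p i) := by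
    rw [Finset.mem_Icc] at hk
    rw [htel, flux_coreSq hχ hc hr0 (h k hk.1 hk.2), hedge k hk.1 hk.2, radius_nbar]
    ring
  rw [Finset.sum_congr rfl hsq, Finset.sum_sub_distrib, ← Finset.mul_sum, ← Finset.mul_sum,
    hsum, hbot]
  ring

include hS hC in
/-- The distributional curl of the strain: every core carries the Burgers vector `τ ε bᵢ`. -/
theorem setIntegral_curlDensity_strain {χ : Plane → ℝ} (hχ : ContDiff ℝ ∞ χ)
    (hc : HasCompactSupport χ) (hs : tsupport χ ⊆ interior (Omega p)) {c : Fin 2 → ℕ → ℝ}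
    (h : ∀ i k, 1 ≤ k → k ≤ numSq p i → ∀ x ∈ coreBdry p i k, χ x = c i k) (a : Fin 2) :
    ∫ x in Omega p, curlDensity χ a (strain p x) x =
      ∑ i, ∑ k ∈ Finset.Icc 1 (numSq p i), p.τ * p.ε * gen p i a * c i k := by
  have hzero (j : Fin 2) (x : Plane) (hx : x ∉ interior (Omega p)) : partialD j χ x = 0 :=
    image_eq_zero_of_notMem_tsupport fun hm => hx (hs (tsupport_partialD_subset χ j hm))
  have hall : ∫ x in Omega p, curlDensity χ a (strain p x) x =
      ∫ x, curlDensity χ a (strain p x) x := by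
    refine setIntegral_eq_integral_of_forall_compl_eq_zero fun x hx => ?_
    have hx' : x ∉ interior (Omega p) := fun h => hx (interior_subset h)
    simp [curlDensity, hzero _ x hx']
  have hbase (x : Plane) (hg : x 0 ≠ 0) : curlDensity χ a (baseField p x) x =
      (halfStrip (-p.L) 0 0 0).indicator (curlDensity χ a (rot (-p.θ))) x +
      (halfStrip 0 p.L 0 0).indicator (curlDensity χ a (rot p.θ)) x := by
    by_cases hx : x ∈ interior (Omega p)
    · obtain ⟨h1, h2, -, h4⟩ := interior_Omega_subset p hx
      rcases lt_or_gt_of_ne hg with h5 | h5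
      · rw [indicator_of_mem (s := halfStrip (-p.L) 0 0 0) ⟨h1, h5, by simpa using h4⟩,
          indicator_of_notMem fun hm => lt_asymm h5 hm.1, baseField, if_pos h5, add_zero]
      · rw [indicator_of_mem (s := halfStrip 0 p.L 0 0) ⟨h5, h2, by simpa using h4⟩,
          indicator_of_notMem fun hm => lt_asymm h5 hm.2.1, baseField, if_neg h5.not_gt, zero_add]
    · have hz (M : Mat) : curlDensity χ a M x = 0 := by simp [curlDensity, hzero _ x hx]
      simp [hz, indicator]
  have hI (P : Set Plane) (hP : MeasurableSet P) (M : Mat) :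
      Integrable (P.indicator (curlDensity χ a M)) :=
    (integrable_curlDensity hχ hc a M).indicator hP
  have hV (P : Set Plane) (hP : MeasurableSet P) (M : Mat) :
      ∫ x, P.indicator (curlDensity χ a M) x = flux χ P (M a) := by
    rw [integral_indicator hP, setIntegral_curlDensity hχ hc]
  have mc (i : Fin 2) (k : ℕ) := (isClosed_coreSq p i k).measurableSet
  have mt (i : Fin 2) (k n : ℕ) (z : Bool) := (isClosed_tri p i k n z).measurableSet
  have mh (l r : ℝ) := measurableSet_halfStrip l r 0 0
  have hae : (fun x => curlDensity χ a (strain p x) x) =ᵐ[volume] fun x =>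
      (halfStrip (-p.L) 0 0 0).indicator (curlDensity χ a (rot (-p.θ))) x +
      (halfStrip 0 p.L 0 0).indicator (curlDensity χ a (rot p.θ)) x +
      ∑ i, ∑ k ∈ Finset.Icc 1 (numSq p i),
        ((coreSq p i k).indicator (curlDensity χ a (1 - rot (sgn i * p.θ))) x +
          ∑ n ∈ Finset.Icc 1 (nbar p i), ∑ z : Bool, (tri p i k n z).indicator
            (curlDensity χ a (triGrad p i k n z - rot (sgn i * p.θ))) x) := by
    filter_upwards [ae_isGeneric p] with x hx
    rw [strain_eq_of_isGeneric hS hC hx, curlDensity_add, hbase x hx.1]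
    simp only [curlDensity_sum, squareField, curlDensity_add, curlDensity_indicator]
  have iT (i : Fin 2) (k n : ℕ) := integrable_finsetSum Finset.univ
    fun z _ => hI _ (mt i k n z) (triGrad p i k n z - rot (sgn i * p.θ))
  have iN (i : Fin 2) (k : ℕ) := integrable_finsetSum (Finset.Icc 1 (nbar p i))
    fun n _ => iT i k n
  have iS (i : Fin 2) (k : ℕ) : Integrable fun x =>
      (coreSq p i k).indicator (curlDensity χ a (1 - rot (sgn i * p.θ))) x +
        ∑ n ∈ Finset.Icc 1 (nbar p i), ∑ z : Bool, (tri p i k n z).indicator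
          (curlDensity χ a (triGrad p i k n z - rot (sgn i * p.θ))) x :=
    (hI _ (mc i k) _).add (iN i k)
  have iK (i : Fin 2) := integrable_finsetSum (Finset.Icc 1 (numSq p i)) fun k _ => iS i k
  have iB : Integrable fun x =>
      (halfStrip (-p.L) 0 0 0).indicator (curlDensity χ a (rot (-p.θ))) x +
      (halfStrip 0 p.L 0 0).indicator (curlDensity χ a (rot p.θ)) x :=
    (hI _ (mh _ _) _).add (hI _ (mh _ _) _)
  rw [hall, integral_congr_ae hae, integral_add iB (integrable_finsetSum _ fun i _ => iK i),
    integral_add (hI _ (mh _ _) _) (hI _ (mh _ _) _),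
    hV _ (mh _ _), hV _ (mh _ _), flux_base hχ hc hS.1 hs,
    integral_finsetSum _ fun i _ => iK i]
  have hin (i : Fin 2) : ∫ x, ∑ k ∈ Finset.Icc 1 (numSq p i),
        ((coreSq p i k).indicator (curlDensity χ a (1 - rot (sgn i * p.θ))) x +
          ∑ n ∈ Finset.Icc 1 (nbar p i), ∑ z : Bool, (tri p i k n z).indicator
            (curlDensity χ a (triGrad p i k n z - rot (sgn i * p.θ))) x) =
      ∑ k ∈ Finset.Icc 1 (numSq p i), p.τ * p.ε * gen p i a * c i k -
      p.τ * p.ε * gen p i a / (2 * spacing p i) * lineIntegral χ 0 0 := by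
    rw [← sum_flux_square hS hC hχ hc hs i (h i) a, integral_finsetSum _ fun k _ =>
      iS i k]
    refine Finset.sum_congr rfl fun k _ => ?_
    rw [integral_add (hI _ (mc i k) _) (iN i k), hV _ (mc i k),
      integral_finsetSum _ fun n _ => iT i k n]
    congr 1
    refine Finset.sum_congr rfl fun n _ => ?_
    rw [integral_finsetSum _ fun z _ => hI _ (mt i k n z) _]
    exact Finset.sum_congr rfl fun z _ => hV _ (mt i k n z) _
  rw [Finset.sum_congr rfl fun i _ => hin i, Finset.sum_sub_distrib, ← Finset.sum_mul,
    burgers_balance hS hC]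
  ring

end

/-! ### Regions enclosed by curves -/

lemma IsSimpleClosedLipschitz.isClosed {γ : Set Plane} (h : IsSimpleClosedLipschitz γ) :
    IsClosed γ := by
  obtain ⟨c, K, hc, -, -, rfl⟩ := h
  exact (isCompact_Icc.image_of_continuousOn hc.continuousOn).isClosed

lemma enclosed_of_mem_component {γ : Set Plane} {x y : Plane}
    (hy : y ∈ connectedComponentIn γᶜ x) : y ∈ enclosed γ ↔ x ∈ enclosed γ := by
  have hx : x ∈ γᶜ := by
    by_contra hx
    rw [connectedComponentIn_eq_empty hx] at hy
    exact hy
  have hy' : y ∈ γᶜ := connectedComponentIn_subset _ _ hy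
  simp only [enclosed, mem_ofPred_eq, connectedComponentIn_eq hy]
  exact ⟨fun h => ⟨hx, h.2⟩, fun h => ⟨hy', h.2⟩⟩

lemma subset_enclosed_of_isPreconnected {γ A : Set Plane} (hA : IsPreconnected A)
    (hAγ : A ⊆ γᶜ) {x : Plane} (hx : x ∈ A) (hxe : x ∈ enclosed γ) : A ⊆ enclosed γ :=
  fun _ hy => (enclosed_of_mem_component (hA.subset_connectedComponentIn hx hAγ hy)).2 hxe

lemma eventually_mem_enclosed_iff {γ : Set Plane} (hγ : IsClosed γ) {x : Plane} (hx : x ∉ γ) :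
    ∀ᶠ y in 𝓝 x, (y ∈ enclosed γ ↔ x ∈ enclosed γ) := by
  filter_upwards [hγ.isOpen_compl.connectedComponentIn.mem_nhds (mem_connectedComponentIn hx)]
    with y hy using enclosed_of_mem_component hy

lemma isOpen_enclosed {γ : Set Plane} (hγ : IsClosed γ) : IsOpen (enclosed γ) := by
  rw [isOpen_iff_mem_nhds]
  intro x hx
  filter_upwards [eventually_mem_enclosed_iff hγ hx.1] with y hy using hy.2 hx

lemma not_isBounded_of_ray {s : Set Plane} {x v : Plane} (hv : v ≠ 0)
    (h : ∀ t : ℝ, 0 ≤ t → x + t • v ∈ s) : ¬ Bornology.IsBounded s := by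
  intro hb
  obtain ⟨C, hC⟩ := hb.exists_norm_le
  have hv' : 0 < ‖v‖ := norm_pos_iff.2 hv
  have hC0 : 0 ≤ C := (norm_nonneg _).trans (hC _ (h 0 le_rfl))
  have h1 := hC _ (h ((C + ‖x‖ + 1) / ‖v‖) (by positivity))
  have h2 : ‖((C + ‖x‖ + 1) / ‖v‖) • v‖ = C + ‖x‖ + 1 := by
    rw [norm_smul, Real.norm_of_nonneg (by positivity)]
    field_simp
  have h3 := norm_sub_le (x + ((C + ‖x‖ + 1) / ‖v‖) • v) x
  rw [add_sub_cancel_left, h2] at h3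
  linarith

/-- From every point outside the rectangle a ray leads to infinity without meeting it, so that a
curve in the rectangle encloses only points of the rectangle. -/
lemma enclosed_subset_Omega {p : Params} {γ : Set Plane} (hγ : γ ⊆ Omega p) :
    enclosed γ ⊆ Omega p := by
  intro x hx
  by_contra hxO
  have hray : ∃ v : Plane, v ≠ 0 ∧ ∀ t : ℝ, 0 ≤ t → x + t • v ∉ Omega p := by
    have hne (j : Fin 2) (u : ℝ) (hu : u ≠ 0) : (EuclideanSpace.single j u : Plane) ≠ 0 := by
      simpa using hu
    by_cases h1 : x 0 < -p.L
    · refine ⟨EuclideanSpace.single 0 (-1), hne _ _ (by norm_num), fun t ht h => ?_⟩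
      have := h.1.1
      simp at this
      linarith
    by_cases h2 : p.L < x 0
    · refine ⟨EuclideanSpace.single 0 1, hne _ _ (by norm_num), fun t ht h => ?_⟩
      have := h.1.2
      simp at this
      linarith
    by_cases h3 : x 1 < -2 * p.L
    · refine ⟨EuclideanSpace.single 1 (-1), hne _ _ (by norm_num), fun t ht h => ?_⟩
      have := h.2.1
      simp at this
      linarith
    by_cases h4 : 0 < x 1
    · refine ⟨EuclideanSpace.single 1 1, hne _ _ (by norm_num), fun t ht h => ?_⟩
      have := h.2.2
      simp at this
      linarith
    · exact absurd ⟨⟨not_lt.1 h1, not_lt.1 h2⟩, not_lt.1 h3, not_lt.1 h4⟩ hxO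
  obtain ⟨v, hv, hout⟩ := hray
  have hconn : IsPreconnected ((fun t : ℝ => x + t • v) '' Ici 0) :=
    isPreconnected_Ici.image _ (by fun_prop)
  have hsub : (fun t : ℝ => x + t • v) '' Ici 0 ⊆ γᶜ := by
    rintro _ ⟨t, ht, rfl⟩ h
    exact hout t ht (hγ h)
  have hmem : x ∈ (fun t : ℝ => x + t • v) '' Ici 0 := ⟨0, mem_Ici.2 le_rfl, by simp⟩
  exact not_isBounded_of_ray hv (fun t ht =>
    hconn.subset_connectedComponentIn hmem hsub ⟨t, ht, rfl⟩) hx.2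

lemma isPreconnected_coreBdry (p : Params) (i : Fin 2) (k : ℕ) :
    IsPreconnected (coreBdry p i k) := by
  have hn (v : Fin 2 → ℝ) : ‖v‖ = max |v 0| |v 1| := by
    apply le_antisymm
    · rw [pi_norm_le_iff_of_nonneg (le_max_of_le_left (abs_nonneg _))]
      intro j
      fin_cases j
      · exact le_max_left _ _
      · exact le_max_right _ _
    · exact max_le (norm_le_pi_norm v 0) (norm_le_pi_norm v 1)
  have he : coreBdry p i k = WithLp.toLp 2 ''
      Metric.sphere (WithLp.ofLp (center p i k)) (radius p i 0) := by
    ext x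
    constructor
    · intro hx
      refine ⟨WithLp.ofLp x, ?_, rfl⟩
      rw [mem_sphere_iff_norm, hn]
      exact hx
    · rintro ⟨y, hy, rfl⟩
      rw [mem_sphere_iff_norm, hn] at hy
      exact hy
  rw [he]
  refine (isPreconnected_sphere ?_ _ _).image _ (PiLp.continuous_toLp 2 _).continuousOn
  rw [rank_fin_fun]
  norm_num

/-! ### Admissibility of the construction -/

lemma isClosed_Omega (p : Params) : IsClosed (Omega p) :=
  (isClosed_Icc.preimage (by fun_prop : Continuous fun x : Plane => x 0)).inter
    (isClosed_Icc.preimage (by fun_prop : Continuous fun x : Plane => x 1))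

lemma isCompact_Omega (p : Params) : IsCompact (Omega p) := by
  have h : Omega p ⊆ WithLp.toLp 2 '' Icc ![-p.L, -2 * p.L] ![p.L, 0] := by
    intro x hx
    refine ⟨WithLp.ofLp x, ⟨fun j => ?_, fun j => ?_⟩, rfl⟩
    · fin_cases j
      · exact hx.1.1
      · exact hx.2.1
    · fin_cases j
      · exact hx.1.2
      · exact hx.2.2
  exact (isCompact_Icc.image (PiLp.continuous_toLp 2 _)).of_isClosed_subset (isClosed_Omega p) h

lemma HasCirculation.mono {β : Plane → Mat} {K K' γ : Set Plane} {v : Plane}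
    (h : HasCirculation β K γ v) (hK : K ⊆ K') : HasCirculation β K' γ v :=
  fun ψ h1 h2 h3 h4 => h ψ h1 h2 (h3.mono_right hK) h4

lemma isClosed_allCoreBdry (p : Params) : IsClosed (allCoreBdry p) := by
  have : allCoreBdry p = ⋃ i, ⋃ k ∈ Finset.Icc 1 (numSq p i), coreBdry p i k := by
    ext x
    simp only [allCoreBdry, mem_ofPred_eq, mem_iUnion, Finset.mem_Icc, exists_prop, and_assoc]
  rw [this]
  exact isClosed_iUnion_of_finite fun i =>
    (Finset.finite_toSet (Finset.Icc 1 (numSq p i))).isClosed_biUnion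
      fun k _ => isClosed_coreBdry p i k

section

variable {p : Params} (hS : Standing p) (hC : SignCond p)

include hS hC in
open Classical in
/-- The circulation of the strain along a curve that avoids the dislocations counts the core
boundaries in the enclosed region. In the weak form, `ψ - 1` cut off to the enclosed region is a
smooth function supported there; it equals `-1` on the enclosed core boundaries and `0` on the
other ones. -/
theorem hasCirculation_strain {γ : Set Plane} (hγ : IsClosed γ)
    (hsub : γ ⊆ Omega p \ dislocations p) :
    HasCirculation (strain p) (dislocations p) γ ((p.τ * p.ε) •
      ∑ i, ∑ k ∈ Finset.Icc 1 (numSq p i),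
        if coreBdry p i k ⊆ enclosed γ then -gen p i else 0) := by
  intro ψ hψ _ hdisj hone a
  set Γ := enclosed γ with hΓ
  have hΓo : IsOpen Γ := isOpen_enclosed hγ
  have hΓΩ : Γ ⊆ Omega p := enclosed_subset_Omega fun x hx => (hsub hx).1
  rw [eventually_nhdsSet_iff_forall] at hone
  set χ : Plane → ℝ := Γ.indicator fun x => ψ x - 1 with hχd
  -- `ψ - 1` vanishes near `γ`, so that the cut-off at `γ` is smooth
  have hin {x : Plane} (hx : x ∈ Γ) : χ =ᶠ[𝓝 x] fun x => ψ x - 1 := by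
    filter_upwards [hΓo.mem_nhds hx] with y hy using indicator_of_mem hy _
  have hout {x : Plane} (hx : x ∉ Γ) : χ =ᶠ[𝓝 x] 0 := by
    by_cases hxγ : x ∈ γ
    · filter_upwards [hone x hxγ] with y hy
      simp [hχd, indicator, hy]
    · filter_upwards [eventually_mem_enclosed_iff hγ hxγ] with y hy
      exact indicator_of_notMem (fun h => hx (hy.1 h)) _
  have hχ : ContDiff ℝ ∞ χ := by
    rw [contDiff_iff_contDiffAt]
    intro x
    by_cases hx : x ∈ Γ
    · exact (hψ.sub contDiff_const).contDiffAt.congr_of_eventuallyEq (hin hx)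
    · exact contDiffAt_const.congr_of_eventuallyEq (hout hx)
  have hts : tsupport χ ⊆ Γ := by
    intro x hx
    by_contra h
    exact (notMem_tsupport_iff_eventuallyEq.2 (hout h)) hx
  have hcs : HasCompactSupport χ :=
    (isCompact_Omega p).of_isClosed_subset (isClosed_tsupport χ) (hts.trans hΓΩ)
  have hfd (j : Fin 2) {x : Plane} (hx : x ∈ Γ) : partialD j ψ x = partialD j χ x := by
    rw [partialD, partialD, (hin hx).fderiv_eq, fderiv_sub_const]
  have hzero (j : Fin 2) {x : Plane} (hx : x ∉ Γ) : partialD j χ x = 0 :=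
    image_eq_zero_of_notMem_tsupport fun hm => hx (hts (tsupport_partialD_subset χ j hm))
  have hbd : ∀ i k, 1 ≤ k → k ≤ numSq p i → ∀ x ∈ coreBdry p i k,
      χ x = if coreBdry p i k ⊆ Γ then -1 else 0 := by
    intro i k hk hk' x hx
    have hγc : coreBdry p i k ⊆ γᶜ := fun y hy hyγ =>
      (hsub hyγ).2 ⟨(hsub hyγ).1, i, k, hk, hk', hy⟩
    split_ifs with hcΓ
    · have hxΓ := hcΓ hx
      have hxd : x ∈ dislocations p := ⟨hΓΩ hxΓ, i, k, hk, hk', hx⟩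
      have hψx : ψ x = 0 := image_eq_zero_of_notMem_tsupport fun h => disjoint_left.1 hdisj h hxd
      simp [hχd, hxΓ, hψx]
    · exact indicator_of_notMem (fun hxΓ => hcΓ
        (subset_enclosed_of_isPreconnected (isPreconnected_coreBdry p i k) hγc hx hxΓ)) _
  have hmain := setIntegral_curlDensity_strain hS hC hχ hcs
    (hts.trans (interior_maximal hΓΩ hΓo)) hbd a
  have h1 : ∫ x in Γ, (partialD 0 ψ x * strain p x a 1 - partialD 1 ψ x * strain p x a 0) =
      ∫ x in Γ, curlDensity χ a (strain p x) x := by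
    refine setIntegral_congr_fun hΓo.measurableSet fun x hx => ?_
    simp only [curlDensity, hfd _ hx]
  have h2 : ∫ x in Γ, curlDensity χ a (strain p x) x =
      ∫ x in Omega p, curlDensity χ a (strain p x) x := by
    refine (setIntegral_eq_of_subset_of_forall_sdiff_eq_zero
      (isClosed_Omega p).measurableSet hΓΩ fun x hx => ?_).symm
    simp [curlDensity, hzero _ hx.2]
  rw [h1, h2, hmain]
  simp only [PiLp.smul_apply, smul_eq_mul, WithLp.ofLp_sum, Finset.sum_apply, Finset.mul_sum]
  refine Finset.sum_congr rfl fun i _ => Finset.sum_congr rfl fun k _ => ?_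
  split_ifs <;> simp

include hS hC in
/-- A curve around a single core has circulation minus the Burgers vector of its strip. -/
theorem hasCirculation_strain_single {i : Fin 2} {k : ℕ} (hk : 1 ≤ k) (hk' : k ≤ numSq p i)
    {γ : Set Plane} (hγ : IsSimpleClosedLipschitz γ) (hsub : γ ⊆ Omega p \ dislocations p)
    (hcore : coreSq p i k ⊆ enclosed γ)
    (hother : ∀ (j : Fin 2) (m : ℕ), 1 ≤ m → m ≤ numSq p j → (j, m) ≠ (i, k) →
      Disjoint (coreSq p j m) (enclosed γ)) :
    HasCirculation (strain p) (dislocations p) γ (-(p.τ * p.ε) • gen p i) := by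
  have h := hasCirculation_strain hS hC hγ.isClosed hsub
  have hn (j : Fin 2) (m : ℕ) (hm : m ∈ Finset.Icc 1 (numSq p j)) (hne : (j, m) ≠ (i, k)) :
      ¬ coreBdry p j m ⊆ enclosed γ := by
    intro hc
    rw [Finset.mem_Icc] at hm
    have hr := radius_pos hS hC j 0
    have hx : (!₂[center p j m 0 + radius p j 0, center p j m 1] : Plane) ∈ coreBdry p j m := by
      change max |center p j m 0 + radius p j 0 - center p j m 0| |center p j m 1 - center p j m 1|
        = radius p j 0
      rw [add_sub_cancel_left, sub_self, abs_zero, abs_of_pos hr, max_eq_left hr.le]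
    exact disjoint_left.1 (hother j m hm.1 hm.2 hne) (coreBdry_subset_coreSq _ _ _ hx) (hc hx)
  rw [Finset.sum_eq_single i, Finset.sum_eq_single k,
    if_pos ((coreBdry_subset_coreSq p i k).trans hcore)] at h
  · rwa [smul_neg, ← neg_smul] at h
  · exact fun m hm hmk => if_neg (hn i m hm fun he => hmk (congrArg Prod.snd he))
  · exact fun hn => absurd (Finset.mem_Icc.2 ⟨hk, hk'⟩) hn
  · exact fun j _ hj => Finset.sum_eq_zero fun m hm =>
      if_neg (hn j m hm fun he => hj (congrArg Prod.fst he))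
  · simp

include hS hC in
lemma memLp_strain (a b : Fin 2) :
    MemLp (fun x => strain p x a b) 2 (volume.restrict (Omega p)) := by
  have : IsFiniteMeasure (volume.restrict (Omega p)) :=
    ⟨by simpa using (isCompact_Omega p).measure_lt_top⟩
  have hI (P : Set Plane) (hP : MeasurableSet P) (M : Mat) :
      MemLp (fun x => P.indicator (fun _ => M) x a b) 2 (volume.restrict (Omega p)) := by
    have he : (fun x => P.indicator (fun _ => M) x a b) = P.indicator fun _ => M a b := by
      funext x
      by_cases hx : x ∈ P <;> simp [hx]
    rw [he]
    exact (memLp_const _).indicator hP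
  have hneg : MeasurableSet {x : Plane | x 0 < 0} :=
    (isOpen_lt (by fun_prop) continuous_const).measurableSet
  have hB : MemLp (fun x => baseField p x a b) 2 (volume.restrict (Omega p)) := by
    have he : (fun x => baseField p x a b) = fun x =>
        {x : Plane | x 0 < 0}.indicator (fun _ => rot (-p.θ)) x a b +
        {x : Plane | x 0 < 0}ᶜ.indicator (fun _ => rot p.θ) x a b := by
      funext x
      by_cases hx : x 0 < 0 <;> simp [baseField, indicator, hx]
    rw [he]
    exact (hI _ hneg _).add (hI _ hneg.compl _)
  have hQ (i : Fin 2) (k : ℕ) :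
      MemLp (fun x => squareField p i k x a b) 2 (volume.restrict (Omega p)) := by
    simp only [squareField, Matrix.add_apply, Matrix.sum_apply]
    exact (hI _ (isClosed_coreSq p i k).measurableSet _).add (memLp_finsetSum _ fun n _ =>
      memLp_finsetSum _ fun z _ => hI _ (isClosed_tri p i k n z).measurableSet _)
  have hM : MemLp (fun x => baseField p x a b +
      ∑ i, ∑ k ∈ Finset.Icc 1 (numSq p i), squareField p i k x a b) 2
      (volume.restrict (Omega p)) :=
    hB.add (memLp_finsetSum _ fun i _ => memLp_finsetSum _ fun k _ => hQ i k)
  refine hM.ae_eq (ae_restrict_of_ae ?_)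
  filter_upwards [ae_isGeneric p] with x hx
  rw [strain_eq_of_isGeneric hS hC hx]
  simp only [Matrix.add_apply, Matrix.sum_apply]

include hS hC in
lemma boundaryCond_strain : BoundaryCond p (strain p) := by
  have hl := spacing_pos hS hC
  have hlayer := layer_add_spacing_le hS hC
  have hS' := hS.2.1
  have hz {x : Plane} (hg : IsGeneric p x) (ho : ∀ i k, x ∉ openSquare p i k) :
      strain p x = baseField p x := by
    rw [strain_eq_of_isGeneric hS hC hg, Finset.sum_eq_zero, add_zero]
    exact fun i _ => Finset.sum_eq_zero fun k _ =>
      squareField_of_notMem_openSquare hS hC hg (ho i k)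
  constructor
  · filter_upwards [ae_isGeneric p] with x hg _ hx
    have hx0 : x 0 < 0 := by linarith [hlayer 0, hl 0]
    rw [hz hg, baseField, if_pos hx0]
    intro i k ho
    have h1 := abs_lt.1 ho.1
    have h2 := hlayer i
    simp only [locX] at h1
    rcases sgn_eq i with h | h <;> rw [h] at h1 <;> linarith [h1.1, h1.2]
  · filter_upwards [ae_isGeneric p] with x hg _ hx
    have hx0 : ¬ x 0 < 0 := by linarith [hlayer 0, hl 0]
    rw [hz hg, baseField, if_neg hx0]
    intro i k ho
    have h1 := abs_lt.1 ho.1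
    have h2 := hlayer i
    simp only [locX] at h1
    rcases sgn_eq i with h | h <;> rw [h] at h1 <;> linarith [h1.1, h1.2]

include hS hC in
lemma curlSupportedIn_strain : CurlSupportedIn p (strain p) (dislocations p) := by
  intro ψ hψ hcs hts a
  have hmain := setIntegral_curlDensity_strain hS hC hψ hcs (hts.trans sdiff_subset)
    (c := fun _ _ => 0) ?_ a
  · have he : (fun x => partialD 1 ψ x * strain p x a 0 - partialD 0 ψ x * strain p x a 1) =
        fun x => -curlDensity ψ a (strain p x) x := by
      funext x
      simp only [curlDensity]
      ring
    rw [he, integral_neg, hmain]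
    simp
  · intro i k hk hk' x hx
    refine image_eq_zero_of_notMem_tsupport fun h => ?_
    exact (hts h).2 ⟨interior_subset (hts h).1, i, k, hk, hk', hx⟩

include hS hC in
theorem strain_mem_admissible : (strain p, dislocations p) ∈ admissible p := by
  have : IsFiniteMeasure (volume.restrict (Omega p)) :=
    ⟨by simpa using (isCompact_Omega p).measure_lt_top⟩
  refine ⟨fun a b => (memLp_strain hS hC a b).integrable one_le_two, inter_subset_left,
    (isClosed_Omega p).inter (isClosed_allCoreBdry p),
    ⟨fun a b => (memLp_strain hS hC a b).mono_measure (Measure.restrict_mono sdiff_subset le_rfl),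
      curlSupportedIn_strain hS hC⟩, fun γ hγ hsub => ?_, boundaryCond_strain hS hC⟩
  have hK : dislocations p ⊆ closedCore p (dislocations p) :=
    (Metric.self_subset_thickening (lam_mul_eps_pos hS) _).trans subset_closure
  classical
  refine ⟨_, ?_, (hasCirculation_strain hS hC hγ.isClosed
    (hsub.trans (sdiff_subset_sdiff_right hK))).mono hK⟩
  refine Submodule.sum_mem _ fun i _ => Submodule.sum_mem _ fun k _ => ?_
  split_ifs
  · exact Submodule.neg_mem _ (Submodule.subset_span ⟨i, rfl⟩)
  · exact Submodule.zero_mem _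

end

/-! ### The energy of the construction -/

lemma rot_mem (t : ℝ) : rot t ∈ Matrix.specialOrthogonalGroup (Fin 2) ℝ := by
  rw [Matrix.mem_specialOrthogonalGroup_iff, Matrix.mem_orthogonalGroup_iff]
  have h := Real.sin_sq_add_cos_sq t
  constructor
  · ext i j
    fin_cases i <;> fin_cases j <;>
      simp [rot, Matrix.mul_apply, Fin.sum_univ_two] <;> linarith
  · rw [rot, Matrix.det_fin_two_of]
    linarith

lemma rot_zero : rot 0 = 1 := by
  ext i j
  fin_cases i <;> fin_cases j <;> simp [rot]

lemma distSO2_nonneg (M : Mat) : 0 ≤ distSO2 M := Real.iInf_nonneg fun _ => Real.sqrt_nonneg _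

/-- Comparison with the single rotation of angle `t`. -/
lemma distSO2_sq_le (M : Mat) (t : ℝ) :
    distSO2 M ^ 2 ≤ ∑ i, ∑ j, (M i j - rot t i j) ^ 2 := by
  have h : distSO2 M ≤ Real.sqrt (∑ i, ∑ j, (M i j - rot t i j) ^ 2) :=
    ciInf_le ⟨0, by
      rintro _ ⟨Q, rfl⟩
      exact Real.sqrt_nonneg _⟩ (⟨rot t, rot_mem t⟩ : Matrix.specialOrthogonalGroup (Fin 2) ℝ)
  calc distSO2 M ^ 2 ≤ Real.sqrt (∑ i, ∑ j, (M i j - rot t i j) ^ 2) ^ 2 :=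
        pow_le_pow_left₀ (distSO2_nonneg M) h 2
    _ = _ := Real.sq_sqrt (by positivity)

lemma distSO2_rot (t : ℝ) : distSO2 (rot t) ^ 2 = 0 :=
  le_antisymm ((distSO2_sq_le _ t).trans (by simp)) (sq_nonneg _)

/-- The closed square of half side `ρ` about the `k`-th centre of strip `i`. -/
def box (p : Params) (i : Fin 2) (k : ℕ) (ρ : ℝ) : Set Plane :=
  {x | |x 0 - center p i k 0| ≤ ρ ∧ |x 1 - center p i k 1| ≤ ρ}

lemma measurableSet_box (p : Params) (i : Fin 2) (k : ℕ) (ρ : ℝ) : MeasurableSet (box p i k ρ) :=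
  ((isClosed_le (f := fun x : Plane => |x 0 - center p i k 0|) (by fun_prop)
    continuous_const).inter (isClosed_le (f := fun x : Plane => |x 1 - center p i k 1|)
    (by fun_prop) continuous_const)).measurableSet

lemma volume_box (p : Params) (i : Fin 2) (k : ℕ) {ρ : ℝ} (hρ : 0 ≤ ρ) :
    volume (box p i k ρ) = ENNReal.ofReal ((2 * ρ) ^ 2) := by
  have hpre : shear 0 0 ⁻¹' box p i k ρ =
      Icc (center p i k 0 - ρ) (center p i k 0 + ρ) ×ˢ
        Icc (center p i k 1 - ρ) (center p i k 1 + ρ) := by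
    ext z
    simp only [box, mem_preimage, mem_ofPred_eq, shear_zero, shear_one, mem_prod, mem_Icc, abs_le,
      zero_mul, zero_add]
    constructor <;> rintro ⟨⟨h1, h2⟩, h3, h4⟩ <;> refine ⟨⟨?_, ?_⟩, ?_, ?_⟩ <;> linarith
  rw [← (measurePreserving_shear 0 0).measure_preimage
    (measurableSet_box p i k ρ).nullMeasurableSet, hpre, Measure.volume_eq_prod,
    Measure.prod_prod, Real.volume_Icc, Real.volume_Icc, ← ENNReal.ofReal_mul (by linarith)]
  congr 1
  ring

lemma sum_unitVec_sq (a : ℝ) : unitVec a 0 ^ 2 + unitVec a 1 ^ 2 = 1 :=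
  Real.cos_sq_add_sin_sq a

lemma thickening_allCoreBdry_subset (p : Params) : Metric.thickening (p.lam * p.ε) (allCoreBdry p) ⊆
    ⋃ i, ⋃ k ∈ Finset.Icc 1 (numSq p i), box p i k (radius p i 0 + p.lam * p.ε) := by
  intro x hx
  obtain ⟨y, ⟨i, k, hk, hk', hy⟩, hxy⟩ := Metric.mem_thickening_iff.1 hx
  simp only [mem_iUnion]
  refine ⟨i, k, Finset.mem_Icc.2 ⟨hk, hk'⟩, ?_⟩
  obtain ⟨h0, h1⟩ := max_le_iff.1 (le_of_eq hy)
  rw [dist_eq_norm] at hxy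
  have hc (j : Fin 2) : |x j - y j| ≤ p.lam * p.ε := (PiLp.norm_apply_le (x - y) j).trans hxy.le
  refine ⟨?_, ?_⟩
  · linarith [abs_sub_le (x 0) (y 0) (center p i k 0), hc 0]
  · linarith [abs_sub_le (x 1) (y 1) (center p i k 1), hc 1]

section

variable {p : Params} (hS : Standing p) (hC : SignCond p)

include hS hC in
/-- On a triangle of the annulus with inner radius `r` the strain is at distance of order
`τ ε / r` from a rotation. -/
lemma distSO2_triGrad_sq_le {i : Fin 2} {k n : ℕ} (hn : 1 ≤ n) (z : Bool) :
    distSO2 (triGrad p i k n z) ^ 2 ≤ (p.τ * p.ε) ^ 2 / (2 * radius p i (n - 1) ^ 2) := by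
  have hr := radius_pos hS hC i (n - 1)
  refine (distSO2_sq_le _ (sgn i * p.θ)).trans ?_
  simp only [triGrad_apply k hn hr, add_sub_cancel_left, Fin.sum_univ_two]
  set r := radius p i (n - 1)
  have hg : gen p i 0 ^ 2 + gen p i 1 ^ 2 = 1 := sum_unitVec_sq _
  have hs : sgn i ^ 2 = 1 := by rw [sq, sgn_mul_self]
  have ht : triCov i r z 0 ^ 2 + triCov i r z 1 ^ 2 ≤ 1 / (2 * r ^ 2) := by
    cases z <;> simp only [triCov, Matrix.cons_val_zero, Matrix.cons_val_one, div_pow, neg_sq, hs]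
    · apply le_of_eq
      field_simp
      norm_num
    · rw [← add_div, div_le_div_iff₀ (by positivity) (by positivity)]
      nlinarith [sq_nonneg r]
  calc _ = (p.τ * p.ε) ^ 2 * sgn i ^ 2 * (gen p i 0 ^ 2 + gen p i 1 ^ 2) *
        (triCov i r z 0 ^ 2 + triCov i r z 1 ^ 2) := by ring
    _ = (p.τ * p.ε) ^ 2 * (triCov i r z 0 ^ 2 + triCov i r z 1 ^ 2) := by rw [hg, hs]; ring
    _ ≤ (p.τ * p.ε) ^ 2 * (1 / (2 * r ^ 2)) := by gcongr
    _ = _ := by ring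

include hS hC in
lemma elastic_density_le (x : Plane) : ENNReal.ofReal (distSO2 (strain p x) ^ 2) ≤
    ∑ i, ∑ k ∈ Finset.Icc 1 (numSq p i), ∑ n ∈ Finset.Icc 1 (nbar p i),
      (box p i k (radius p i n)).indicator
        (fun _ => ENNReal.ofReal ((p.τ * p.ε) ^ 2 / (2 * radius p i (n - 1) ^ 2))) x := by
  unfold strain
  split_ifs with h1 h2 h3
  · rw [← rot_zero, distSO2_rot]
    simp
  · obtain ⟨hk, hk', hn, hn', hx⟩ := h2.choose_spec
    obtain ⟨hb1, hb2, hb3⟩ := bounds_of_mem_tri hS hC hn hx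
    set t := h2.choose
    have hpos := radius_pos hS hC t.1 (t.2.2.1 - 1)
    have hbox : x ∈ box p t.1 t.2.1 (radius p t.1 t.2.2.1) := by
      refine ⟨?_, ?_⟩
      · rw [abs_fst_sub_center, abs_of_pos (by linarith)]
        exact hb2
      · rw [snd_sub_center]
        linarith
    calc _ ≤ ENNReal.ofReal ((p.τ * p.ε) ^ 2 / (2 * radius p t.1 (t.2.2.1 - 1) ^ 2)) :=
          ENNReal.ofReal_le_ofReal (distSO2_triGrad_sq_le hS hC hn _)
      _ = (box p t.1 t.2.1 (radius p t.1 t.2.2.1)).indicator (fun _ =>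
          ENNReal.ofReal ((p.τ * p.ε) ^ 2 / (2 * radius p t.1 (t.2.2.1 - 1) ^ 2))) x :=
          by rw [indicator_of_mem hbox]
      _ ≤ ∑ n ∈ Finset.Icc 1 (nbar p t.1), (box p t.1 t.2.1 (radius p t.1 n)).indicator
          (fun _ => ENNReal.ofReal ((p.τ * p.ε) ^ 2 / (2 * radius p t.1 (n - 1) ^ 2))) x :=
          Finset.single_le_sum (f := fun n => (box p t.1 t.2.1 (radius p t.1 n)).indicator
            (fun _ => ENNReal.ofReal ((p.τ * p.ε) ^ 2 / (2 * radius p t.1 (n - 1) ^ 2))) x)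
            (fun _ _ => zero_le) (Finset.mem_Icc.2 ⟨hn, hn'⟩)
      _ ≤ _ := Finset.single_le_sum (f := fun k => ∑ n ∈ Finset.Icc 1 (nbar p t.1),
            (box p t.1 k (radius p t.1 n)).indicator
            (fun _ => ENNReal.ofReal ((p.τ * p.ε) ^ 2 / (2 * radius p t.1 (n - 1) ^ 2))) x)
            (fun _ _ => zero_le) (Finset.mem_Icc.2 ⟨hk, hk'⟩)
      _ ≤ _ := Finset.single_le_sum (f := fun i => ∑ k ∈ Finset.Icc 1 (numSq p i),
            ∑ n ∈ Finset.Icc 1 (nbar p i), (box p i k (radius p i n)).indicator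
            (fun _ => ENNReal.ofReal ((p.τ * p.ε) ^ 2 / (2 * radius p i (n - 1) ^ 2))) x)
            (fun _ _ => zero_le) (Finset.mem_univ t.1)
  · simp [distSO2_rot]
  · simp [distSO2_rot]

include hS hC in
/-- Every annulus carries the same elastic energy, of order `τ² ε²`. -/
lemma lintegral_elastic_le (P : Set Plane) :
    ∫⁻ x in P, ENNReal.ofReal (distSO2 (strain p x) ^ 2) ≤
      ENNReal.ofReal (∑ i, numSq p i * (nbar p i * (8 * (p.τ * p.ε) ^ 2))) := by
  have hm (i : Fin 2) (k n : ℕ) : Measurable ((box p i k (radius p i n)).indicator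
      (fun _ => ENNReal.ofReal ((p.τ * p.ε) ^ 2 / (2 * radius p i (n - 1) ^ 2)))) :=
    measurable_const.indicator (measurableSet_box p i k _)
  have hv (i : Fin 2) (k n : ℕ) (hn : n ∈ Finset.Icc 1 (nbar p i)) :
      ∫⁻ x, (box p i k (radius p i n)).indicator
        (fun _ => ENNReal.ofReal ((p.τ * p.ε) ^ 2 / (2 * radius p i (n - 1) ^ 2))) x =
      ENNReal.ofReal (8 * (p.τ * p.ε) ^ 2) := by
    rw [lintegral_indicator_const (measurableSet_box p i k _),
      volume_box p i k (radius_pos hS hC i n).le, ← ENNReal.ofReal_mul (by positivity),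
      radius_eq_two_mul p i (Finset.mem_Icc.1 hn).1]
    have := (radius_pos hS hC i (n - 1)).ne'
    congr 1
    field_simp
    norm_num
  calc _ ≤ ∫⁻ x, ENNReal.ofReal (distSO2 (strain p x) ^ 2) := setLIntegral_le_lintegral _ _
    _ ≤ ∫⁻ x, ∑ i, ∑ k ∈ Finset.Icc 1 (numSq p i), ∑ n ∈ Finset.Icc 1 (nbar p i),
        (box p i k (radius p i n)).indicator
        (fun _ => ENNReal.ofReal ((p.τ * p.ε) ^ 2 / (2 * radius p i (n - 1) ^ 2))) x :=
      lintegral_mono fun x => elastic_density_le hS hC x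
    _ = ∑ i, ∑ k ∈ Finset.Icc 1 (numSq p i), ∑ n ∈ Finset.Icc 1 (nbar p i),
        ENNReal.ofReal (8 * (p.τ * p.ε) ^ 2) := by
      rw [lintegral_finsetSum _ fun i _ => Finset.measurable_sum _ fun k _ =>
        Finset.measurable_sum _ fun n _ => hm i k n]
      refine Finset.sum_congr rfl fun i _ => ?_
      rw [lintegral_finsetSum _ fun k _ => Finset.measurable_sum _ fun n _ => hm i k n]
      refine Finset.sum_congr rfl fun k _ => ?_
      rw [lintegral_finsetSum _ fun n _ => hm i k n]
      exact Finset.sum_congr rfl fun n hn => hv i k n hn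
    _ = _ := by
      rw [ENNReal.ofReal_sum_of_nonneg fun i _ => by positivity]
      refine Finset.sum_congr rfl fun i _ => ?_
      rw [Finset.sum_const, Finset.sum_const, Nat.card_Icc, Nat.card_Icc,
        ENNReal.ofReal_mul (by positivity), ENNReal.ofReal_mul (by positivity)]
      simp

include hS hC in
lemma volume_thickening_le : volume (Metric.thickening (p.lam * p.ε) (allCoreBdry p)) ≤
    ENNReal.ofReal (∑ i, numSq p i * (36 * (p.lam * p.ε) ^ 2)) := by
  have hl := lam_mul_eps_pos hS
  calc _ ≤ volume (⋃ i, ⋃ k ∈ Finset.Icc 1 (numSq p i),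
        box p i k (radius p i 0 + p.lam * p.ε)) := measure_mono (thickening_allCoreBdry_subset p)
    _ ≤ ∑ i, volume (⋃ k ∈ Finset.Icc 1 (numSq p i), box p i k (radius p i 0 + p.lam * p.ε)) :=
      measure_iUnion_fintype_le _ _
    _ ≤ ∑ i, ∑ k ∈ Finset.Icc 1 (numSq p i), volume (box p i k (radius p i 0 + p.lam * p.ε)) :=
      Finset.sum_le_sum fun i _ => measure_biUnion_finset_le _ _
    _ ≤ ∑ i, ∑ k ∈ Finset.Icc 1 (numSq p i), ENNReal.ofReal (36 * (p.lam * p.ε) ^ 2) := by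
      refine Finset.sum_le_sum fun i _ => Finset.sum_le_sum fun k _ => ?_
      have hr := radius_pos hS hC i 0
      have hr' := radius_zero_lt hS hC i
      rw [volume_box p i k (by linarith)]
      refine ENNReal.ofReal_le_ofReal ?_
      calc (2 * (radius p i 0 + p.lam * p.ε)) ^ 2 ≤ (6 * (p.lam * p.ε)) ^ 2 :=
            pow_le_pow_left₀ (by linarith) (by linarith) 2
        _ = _ := by ring
    _ = _ := by
      rw [ENNReal.ofReal_sum_of_nonneg fun i _ => by positivity]
      refine Finset.sum_congr rfl fun i _ => ?_
      rw [Finset.sum_const, Nat.card_Icc, ENNReal.ofReal_mul (by positivity)]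
      simp

include hS hC in
lemma numSq_le (i : Fin 2) : (numSq p i : ℝ) ≤ 2 * (p.L / spacing p i) := by
  have hl := spacing_pos hS hC i
  have h := layer_add_spacing_le hS hC i
  have h1 : 1 ≤ p.L / spacing p i := by
    rw [one_le_div hl]
    linarith [hS.2.1]
  have h2 : (numSq p i : ℝ) < p.L / spacing p i + 1 := Nat.ceil_lt_add_one (by linarith)
  linarith

include hS hC in
lemma E0_pos : 0 < E0 p := by
  obtain ⟨h1, h2, h3⟩ := sin_ne_zero hC
  have hp : 0 < Real.sin p.φ / Real.sin (p.φ - p.η) := by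
    rw [← inv_div]
    exact inv_pos.2 hC.2
  have he : Real.sin p.η / Real.sin (p.φ - p.η) < 0 := by
    rw [← inv_div]
    exact inv_lt_zero.2 hC.1
  unfold E0
  rw [sub_div]
  exact mul_pos hS.2.2.2.2.2.1 (by linarith)

include hS hC in
/-- In terms of the spacings the energy bound is the sum over the strips of the number of
dislocations times the logarithm of the ratio of spacing and core size. -/
lemma bound_eq_sum : p.ε * p.L * E0 p * Real.sin p.θ * (constA p - Real.logb 2 (Real.sin p.θ)) =
    ∑ i, (p.τ * p.ε) ^ 2 / 4 * (p.L / spacing p i) *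
      (1 + Real.logb 2 (spacing p i / (p.lam * p.ε))) := by
  have hs := sin_theta_pos hS
  obtain ⟨h1, h2, h3⟩ := sin_ne_zero hC
  have ht := hS.2.2.2.2.2.1
  have he := hS.2.2.1
  have hl : 0 < p.lam := ht.trans hS.2.2.2.2.2.2.1
  have hE := (E0_pos hS hC).ne'
  have hl0 := spacing_pos hS hC 0
  have hl1 := spacing_pos hS hC 1
  have hq0 : -(p.τ * Real.sin (p.φ - p.η) / (4 * p.lam * Real.sin p.η)) =
      spacing p 0 / (p.lam * p.ε) * Real.sin p.θ := by
    change _ = -(p.τ * p.ε / 4) * (Real.sin (p.φ - p.η) / (Real.sin p.θ * Real.sin p.η)) /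
      (p.lam * p.ε) * Real.sin p.θ
    field_simp
  have hq1 : p.τ * Real.sin (p.φ - p.η) / (4 * p.lam * Real.sin p.φ) =
      spacing p 1 / (p.lam * p.ε) * Real.sin p.θ := by
    change _ = (p.τ * p.ε / 4) * (Real.sin (p.φ - p.η) / (Real.sin p.θ * Real.sin p.φ)) /
      (p.lam * p.ε) * Real.sin p.θ
    field_simp
  have hE1 : E1 p = p.τ * (Real.sin p.φ / Real.sin (p.φ - p.η) *
      (Real.logb 2 (spacing p 1 / (p.lam * p.ε)) + Real.logb 2 (Real.sin p.θ)) -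
      Real.sin p.η / Real.sin (p.φ - p.η) *
      (Real.logb 2 (spacing p 0 / (p.lam * p.ε)) + Real.logb 2 (Real.sin p.θ))) := by
    rw [E1, hq0, hq1, Real.logb_mul (by positivity) hs.ne', Real.logb_mul (by positivity) hs.ne']
  have hi0 : p.L / spacing p 0 = -(4 / (p.τ * p.ε)) * p.L * Real.sin p.θ *
      (Real.sin p.η / Real.sin (p.φ - p.η)) := by
    change p.L / (-(p.τ * p.ε / 4) * (Real.sin (p.φ - p.η) / (Real.sin p.θ * Real.sin p.η))) = _
    field_simp
  have hi1 : p.L / spacing p 1 = (4 / (p.τ * p.ε)) * p.L * Real.sin p.θ *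
      (Real.sin p.φ / Real.sin (p.φ - p.η)) := by
    change p.L / ((p.τ * p.ε / 4) * (Real.sin (p.φ - p.η) / (Real.sin p.θ * Real.sin p.φ))) = _
    field_simp
  have hA : E0 p * (constA p - Real.logb 2 (Real.sin p.θ)) =
      E1 p + E0 p - E0 p * Real.logb 2 (Real.sin p.θ) := by
    unfold constA
    field_simp
  rw [Fin.sum_univ_two, hi0, hi1]
  calc _ = p.ε * p.L * Real.sin p.θ *
        (E0 p * (constA p - Real.logb 2 (Real.sin p.θ))) := by ring
    _ = _ := by
      rw [hA, hE1, E0]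
      field_simp
      ring

include hS hC in
/-- The number of cores is of order `L / ℓᵢ` in each strip, and each of them costs of order `τ² ε²`
per dyadic annulus and of order `τ² ε²` for the core. The elastic energy is bounded on the whole
plane, so that the bound does not depend on the part of the core boundaries that is removed. -/
theorem energy_strain_le {S' : Set Plane} (hS' : S' ⊆ allCoreBdry p) :
    energy p (strain p) S' ≤ ENNReal.ofReal
      (288 * p.ε * p.L * E0 p * Real.sin p.θ * (constA p - Real.logb 2 (Real.sin p.θ))) := by
  have hl : 0 < p.lam := hS.2.2.2.2.2.1.trans hS.2.2.2.2.2.2.1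
  have hL := hS.1
  have e : 288 * p.ε * p.L * E0 p * Real.sin p.θ * (constA p - Real.logb 2 (Real.sin p.θ)) =
      288 * (p.ε * p.L * E0 p * Real.sin p.θ * (constA p - Real.logb 2 (Real.sin p.θ))) := by ring
  calc energy p (strain p) S' ≤ ENNReal.ofReal
        (∑ i, numSq p i * (nbar p i * (8 * (p.τ * p.ε) ^ 2))) +
        ENNReal.ofReal (p.τ ^ 2 / p.lam ^ 2) *
          ENNReal.ofReal (∑ i, numSq p i * (36 * (p.lam * p.ε) ^ 2)) :=
      add_le_add (lintegral_elastic_le hS hC _) (mul_le_mul_right ((measure_mono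
        (Metric.thickening_subset_of_subset _ hS')).trans (volume_thickening_le hS hC)) _)
    _ = ENNReal.ofReal (∑ i, numSq p i * ((8 * nbar p i + 36) * (p.τ * p.ε) ^ 2)) := by
      rw [← ENNReal.ofReal_mul (by positivity), ← ENNReal.ofReal_add (by positivity)
        (by positivity), Finset.mul_sum, ← Finset.sum_add_distrib]
      congr 1
      refine Finset.sum_congr rfl fun i _ => ?_
      field_simp
    _ ≤ _ := by
      rw [e, bound_eq_sum hS hC, Finset.mul_sum]
      refine ENNReal.ofReal_le_ofReal (Finset.sum_le_sum fun i _ => ?_)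
      have hn : (nbar p i : ℝ) ≤ Real.logb 2 (spacing p i / (p.lam * p.ε)) :=
        Nat.floor_le (logb_nonneg hS hC i)
      have hsp := spacing_pos hS hC i
      calc (numSq p i : ℝ) * ((8 * nbar p i + 36) * (p.τ * p.ε) ^ 2) ≤
          2 * (p.L / spacing p i) *
            ((36 * (1 + Real.logb 2 (spacing p i / (p.lam * p.ε)))) * (p.τ * p.ε) ^ 2) := by
            refine mul_le_mul (numSq_le hS hC i) ?_ (by positivity) (by positivity)
            refine mul_le_mul_of_nonneg_right ?_ (sq_nonneg _)
            have := logb_nonneg hS hC i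
            linarith
        _ = _ := by ring

include hS hC in
lemma constA_eq : constA p = 1 + Real.logb 2 (p.τ * |Real.sin (p.φ - p.η)| / (4 * p.lam)) +
    (Real.sin p.η * Real.logb 2 |Real.sin p.η| - Real.sin p.φ * Real.logb 2 |Real.sin p.φ|) /
      (Real.sin p.φ - Real.sin p.η) := by
  obtain ⟨h1, h2, h3⟩ := sin_ne_zero hC
  have ht := hS.2.2.2.2.2.1
  have hl : 0 < p.lam := ht.trans hS.2.2.2.2.2.2.1
  have hE := E0_pos hS hC
  have hd : Real.sin p.φ - Real.sin p.η ≠ 0 := by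
    intro h
    rw [E0, h] at hE
    simp at hE
  have hX : Real.logb 2 (p.τ * |Real.sin (p.φ - p.η)| / (4 * p.lam)) =
      Real.logb 2 (p.τ * Real.sin (p.φ - p.η) / (4 * p.lam)) := by
    rw [← Real.logb_abs _ (p.τ * Real.sin (p.φ - p.η) / (4 * p.lam)), abs_div, abs_mul,
      abs_of_pos ht, abs_of_pos (show 0 < 4 * p.lam by positivity)]
  have hlog (a : ℝ) (ha : a ≠ 0) :
      Real.logb 2 (p.τ * Real.sin (p.φ - p.η) / (4 * p.lam * a)) =
      Real.logb 2 (p.τ * Real.sin (p.φ - p.η) / (4 * p.lam)) - Real.logb 2 a := by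
    rw [← div_div, Real.logb_div _ ha]
    exact div_ne_zero (mul_ne_zero ht.ne' h3) (by positivity)
  rw [constA, E1, E0, hX, Real.logb_abs, Real.logb_abs, Real.logb_neg_eq_logb, hlog _ h1,
    hlog _ h2]
  have ht' := ht.ne'
  generalize Real.logb 2 (p.τ * Real.sin (p.φ - p.η) / (4 * p.lam)) = X
  field_simp
  ring

end

/-! ### Removing the sign conditions -/

/-- The parameters with the directions of the generators replaced. -/
def Params.withAngles (p : Params) (φ η : ℝ) : Params := { p with φ := φ, η := η }

lemma unitVec_eq_or_neg {a b : ℝ} (h : a = b ∨ a = b + Real.pi) :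
    unitVec a = unitVec b ∨ unitVec a = -unitVec b := by
  rcases h with rfl | rfl
  · exact Or.inl rfl
  · refine Or.inr (plane_ext ?_ ?_) <;> simp [unitVec, Real.cos_add_pi, Real.sin_add_pi]

lemma lattice_withAngles_le {p : Params} {φ η : ℝ} (hφ : unitVec φ = unitVec p.φ ∨
    unitVec φ = -unitVec p.φ) (hη : unitVec η = unitVec p.η ∨ unitVec η = -unitVec p.η) :
    lattice (p.withAngles φ η) ≤ lattice p := by
  refine Submodule.span_le.2 ?_
  have h0 : unitVec p.φ ∈ lattice p := Submodule.subset_span ⟨0, rfl⟩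
  have h1 : unitVec p.η ∈ lattice p := Submodule.subset_span ⟨1, rfl⟩
  rintro _ ⟨i, rfl⟩
  fin_cases i
  · change unitVec φ ∈ lattice p
    rcases hφ with h | h <;> rw [h]
    · exact h0
    · exact Submodule.neg_mem _ h0
  · change unitVec η ∈ lattice p
    rcases hη with h | h <;> rw [h]
    · exact h1
    · exact Submodule.neg_mem _ h1

lemma lattice_withAngles {p : Params} {φ η : ℝ} (hφ : φ = p.φ ∨ φ = p.φ + Real.pi)
    (hη : η = p.η ∨ η = p.η + Real.pi) : lattice (p.withAngles φ η) = lattice p := by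
  have h1 := unitVec_eq_or_neg hφ
  have h2 := unitVec_eq_or_neg hη
  refine le_antisymm (lattice_withAngles_le h1 h2) ?_
  have hsymm {u v : Plane} (h : u = v ∨ u = -v) : v = u ∨ v = -u := by
    rcases h with rfl | rfl
    · exact Or.inl rfl
    · exact Or.inr (neg_neg _).symm
  exact lattice_withAngles_le (p := p.withAngles φ η) (hsymm h1) (hsymm h2)

lemma admissible_withAngles {p : Params} {φ η : ℝ} (h : lattice (p.withAngles φ η) = lattice p) :
    admissible (p.withAngles φ η) = admissible p := by
  have hc : CirculationCond (p.withAngles φ η) = CirculationCond p := by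
    funext β S
    unfold CirculationCond
    rw [h]
    rfl
  unfold admissible
  rw [hc]
  rfl

lemma standing_withAngles {p : Params} (hS : Standing p) {φ η : ℝ}
    (hφ : φ = p.φ ∨ φ = p.φ + Real.pi) (hη : η = p.η ∨ η = p.η + Real.pi) :
    Standing (p.withAngles φ η) := by
  have hD : |Real.sin (φ - η)| = |Real.sin (p.φ - p.η)| := by
    rcases hφ with rfl | rfl <;> rcases hη with rfl | rfl
    · rfl
    · rw [← sub_sub, Real.sin_sub_pi, abs_neg]
    · rw [add_sub_right_comm, Real.sin_add_pi, abs_neg]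
    · rw [add_sub_add_right_eq_sub]
  have hφ' : |Real.sin φ| = |Real.sin p.φ| := by
    rcases hφ with rfl | rfl
    · rfl
    · rw [Real.sin_add_pi, abs_neg]
  have hη' : |Real.sin η| = |Real.sin p.η| := by
    rcases hη with rfl | rfl
    · rfl
    · rw [Real.sin_add_pi, abs_neg]
  have hsp (i : Fin 2) : |spacing (p.withAngles φ η) i| = |spacing p i| := by
    fin_cases i
    · change |-(p.τ * p.ε / 4) * (Real.sin (φ - η) / (Real.sin p.θ * Real.sin η))| =
        |-(p.τ * p.ε / 4) * (Real.sin (p.φ - p.η) / (Real.sin p.θ * Real.sin p.η))|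
      simp only [abs_mul, abs_div, abs_neg, hD, hη']
    · change |(p.τ * p.ε / 4) * (Real.sin (φ - η) / (Real.sin p.θ * Real.sin φ))| =
        |(p.τ * p.ε / 4) * (Real.sin (p.φ - p.η) / (Real.sin p.θ * Real.sin p.φ))|
      simp only [abs_mul, abs_div, hD, hφ']
  obtain ⟨h1, h2, h3, h4, h5, h6, h7, h8, h9⟩ := hS
  exact ⟨h1, h2, h3, h4, h5, h6, h7, fun i => by rw [hsp]; exact h8 i,
    fun i => by rw [hsp]; exact h9 i⟩

/-- Replacing the generators by their opposites, which does not change the lattice, achieves the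
sign conditions: reversing `b₁` flips the sign of `sin (φ - η) / sin η` only, and reversing `b₂`
flips that of `sin (φ - η) / sin φ` only. -/
lemma exists_angles {φ η : ℝ} (hφ : Real.sin φ ≠ 0) (hη : Real.sin η ≠ 0)
    (hD : Real.sin (φ - η) ≠ 0) :
    ∃ φ' η', (φ' = φ ∨ φ' = φ + Real.pi) ∧ (η' = η ∨ η' = η + Real.pi) ∧
      Real.sin (φ' - η') / Real.sin η' < 0 ∧ 0 < Real.sin (φ' - η') / Real.sin φ' := by
  rcases (div_ne_zero hD hη).lt_or_gt with h1 | h1 <;>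
    rcases (div_ne_zero hD hφ).lt_or_gt with h2 | h2
  · refine ⟨φ, η + Real.pi, Or.inl rfl, Or.inr rfl, ?_⟩
    rw [← sub_sub, Real.sin_sub_pi, Real.sin_add_pi, neg_div_neg_eq, neg_div]
    exact ⟨h1, neg_pos.2 h2⟩
  · exact ⟨φ, η, Or.inl rfl, Or.inl rfl, h1, h2⟩
  · refine ⟨φ + Real.pi, η + Real.pi, Or.inr rfl, Or.inr rfl, ?_⟩
    rw [add_sub_add_right_eq_sub, Real.sin_add_pi, Real.sin_add_pi, div_neg, div_neg]
    exact ⟨neg_neg_iff_pos.2 h1, neg_pos.2 h2⟩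
  · refine ⟨φ + Real.pi, η, Or.inr rfl, Or.inl rfl, ?_⟩
    rw [add_sub_right_comm, Real.sin_add_pi, Real.sin_add_pi, neg_div_neg_eq, neg_div]
    exact ⟨neg_neg_iff_pos.2 h1, h2⟩

/-- For `0 < θ ≤ π / 2` the logarithm of `sin θ` is controlled by that of `θ`, as
`sin θ ≥ 2 θ / π`. -/
lemma sub_logb_sin_le {θ : ℝ} (h0 : 0 < θ) (h1 : θ ≤ Real.pi / 2) (A : ℝ) :
    A - Real.logb 2 (Real.sin θ) ≤
      (|A| + (1 + Real.log (Real.pi / 2)) / Real.log 2) * (|Real.log θ| + 1) := by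
  have hpi := Real.pi_pos
  have hs : 2 / Real.pi * θ ≤ Real.sin θ := Real.mul_le_sin h0.le h1
  have hl2 : 0 < Real.log 2 := Real.log_pos (by norm_num)
  have hlp : 0 ≤ Real.log (Real.pi / 2) := Real.log_nonneg (by linarith [Real.pi_gt_three])
  have h2 : -Real.log (Real.sin θ) ≤ |Real.log θ| + Real.log (Real.pi / 2) := by
    have h3 : Real.log (2 / Real.pi * θ) ≤ Real.log (Real.sin θ) :=
      Real.log_le_log (by positivity) hs
    rw [Real.log_mul (by positivity) h0.ne', ← inv_div, Real.log_inv] at h3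
    linarith [neg_abs_le (Real.log θ)]
  have h4 : -Real.logb 2 (Real.sin θ) ≤
      (|Real.log θ| + Real.log (Real.pi / 2)) / Real.log 2 := by
    rw [Real.logb, ← neg_div]
    gcongr
  have h5 := abs_nonneg (Real.log θ)
  have h6 : (|Real.log θ| + Real.log (Real.pi / 2)) / Real.log 2 ≤
      (1 + Real.log (Real.pi / 2)) / Real.log 2 * (|Real.log θ| + 1) := by
    rw [div_mul_eq_mul_div]
    gcongr
    nlinarith [mul_nonneg hlp h5]
  have h7 := le_abs_self A
  nlinarith [mul_nonneg (abs_nonneg A) h5]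

theorem iInf_energy_le {τ lam φ η : ℝ} (hφ : Real.sin φ ≠ 0) (hη : Real.sin η ≠ 0)
    (hD : Real.sin (φ - η) ≠ 0) :
    ∃ C : ℝ, 0 < C ∧ ∀ p : Params, p.τ = τ → p.lam = lam → p.φ = φ → p.η = η → Standing p →
      (⨅ q ∈ admissible p, energy p q.1 q.2) ≤
        ENNReal.ofReal (C * p.L * p.ε * p.θ * (|Real.log p.θ| + 1)) := by
  obtain ⟨φ', η', hφ', hη', hsign⟩ := exists_angles hφ hη hD
  -- the constants depend only on the last four parameters
  set E : ℝ := E0 ⟨0, 0, 0, 0, τ, lam, φ', η'⟩ with hE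
  set A : ℝ := constA ⟨0, 0, 0, 0, τ, lam, φ', η'⟩ with hA
  have hM : 0 < |A| + (1 + Real.log (Real.pi / 2)) / Real.log 2 := by
    have hl2 : 0 < Real.log 2 := Real.log_pos (by norm_num)
    have hlp : 0 ≤ Real.log (Real.pi / 2) := Real.log_nonneg (by linarith [Real.pi_gt_three])
    positivity
  refine ⟨288 * (|E| + 1) * (|A| + (1 + Real.log (Real.pi / 2)) / Real.log 2),
    by positivity, ?_⟩
  rintro p rfl rfl rfl rfl hS
  have hS' := standing_withAngles hS hφ' hη'
  have hadm := strain_mem_admissible hS' hsign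
  rw [admissible_withAngles (lattice_withAngles hφ' hη')] at hadm
  refine (iInf₂_le _ hadm).trans ((energy_strain_le hS' hsign inter_subset_right).trans
    (ENNReal.ofReal_le_ofReal ?_))
  change 288 * p.ε * p.L * E * Real.sin p.θ * (A - Real.logb 2 (Real.sin p.θ)) ≤ _
  have hEpos : 0 < E := (show 0 < E0 (p.withAngles φ' η') from E0_pos hS' hsign)
  have hs := sin_theta_pos hS
  have hL := hS.1
  have hε := hS.2.2.1
  have hθ := hS.2.2.2.1
  have hsθ : Real.sin p.θ ≤ p.θ := Real.sin_le hθ.le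
  have hEle : E ≤ |E| + 1 := by linarith [le_abs_self E]
  calc 288 * p.ε * p.L * E * Real.sin p.θ * (A - Real.logb 2 (Real.sin p.θ)) ≤
      288 * p.ε * p.L * E * Real.sin p.θ *
        ((|A| + (1 + Real.log (Real.pi / 2)) / Real.log 2) * (|Real.log p.θ| + 1)) := by
        gcongr
        exact sub_logb_sin_le hθ hS.2.2.2.2.1 A
    _ ≤ 288 * p.ε * p.L * (|E| + 1) * p.θ *
        ((|A| + (1 + Real.log (Real.pi / 2)) / Real.log 2) * (|Real.log p.θ| + 1)) := by
        gcongr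
    _ = _ := by ring

end GrainBoundary

end

theorem mainTheorem1 :
    -- the construction is admissible, with a universal constant in the energy bound
    (∃ C : ℝ, 0 < C ∧ ∀ p : Params, Standing p → SignCond p →
      (strain p, dislocations p) ∈ admissible p ∧
      (∀ (i : Fin 2) (k : ℕ), 1 ≤ k → k ≤ numSq p i → ∀ γ : Set Plane,
        IsSimpleClosedLipschitz γ → γ ⊆ Omega p \ dislocations p →
        coreSq p i k ⊆ enclosed γ →
        (∀ (j : Fin 2) (m : ℕ), 1 ≤ m → m ≤ numSq p j → (j, m) ≠ (i, k) →
          Disjoint (coreSq p j m) (enclosed γ)) →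
        HasCirculation (strain p) (dislocations p) γ (-(p.τ * p.ε) • gen p i)) ∧
      energy p (strain p) (dislocations p) ≤ ENNReal.ofReal
        (C * p.ε * p.L * E0 p * Real.sin p.θ * (constA p - Real.logb 2 (Real.sin p.θ))) ∧
      energy p (strain p) (allCoreBdry p) ≤ ENNReal.ofReal
        (C * p.ε * p.L * E0 p * Real.sin p.θ * (constA p - Real.logb 2 (Real.sin p.θ))) ∧
      constA p = 1 + Real.logb 2 (p.τ * |Real.sin (p.φ - p.η)| / (4 * p.lam)) +
        (Real.sin p.η * Real.logb 2 |Real.sin p.η| - Real.sin p.φ * Real.logb 2 |Real.sin p.φ|) /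
          (Real.sin p.φ - Real.sin p.η)) ∧
    -- the resulting upper bound for the infimum of the energy
    (∀ τ lam φ η : ℝ, 0 < τ → τ < lam →
      Real.sin φ ≠ 0 → Real.sin η ≠ 0 → Real.sin (φ - η) ≠ 0 →
      ∃ C : ℝ, 0 < C ∧ ∀ p : Params, p.τ = τ → p.lam = lam → p.φ = φ → p.η = η → Standing p →
        (⨅ q ∈ admissible p, energy p q.1 q.2) ≤
          ENNReal.ofReal (C * p.L * p.ε * p.θ * (|Real.log p.θ| + 1))) := by
  refine ⟨⟨288, by norm_num, fun p hS hC => ⟨strain_mem_admissible hS hC, ?_,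
    energy_strain_le hS hC Set.inter_subset_right, energy_strain_le hS hC subset_rfl,
    constA_eq hS hC⟩⟩, ?_⟩
  · intro i k hk hk' γ hγ hsub hcore hother
    exact hasCirculation_strain_single hS hC hk hk' hγ hsub hcore hother
  · intro τ lam φ η _ _ hφ hη hD
    exact iInf_energy_le hφ hη hD
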